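/- **Averaging principle in the case of rapidly oscillating wind forcing.** Let $D=\mathbb R^2/\mathbb Z^2$ with coordinates $(x,z)$, let $\nu,Pr,N>0$, and on real distributions on $D$ with mean zero put $\mathcal A_1=-\nu\Delta$, $\mathcal A_2=-\frac{\nu}{Pr}\Delta$ and $J(a,b)=a_xb_z-a_zb_x$. For $s\in\mathbb R$ let $D(\mathcal A_i^{s})$ be the space of real mean-zero periodic distributions $u$ with $\|\mathcal A_i^{s}u\|_{L^2}<\infty$; in particular $D(\mathcal A_1^{1/2})=D(\mathcal A_2^{1/2})=H^1_{per0}$. Write $\|\omega\|_{1/2}=\|\mathcal A_1^{1/2}\omega\|_{L^2}$ for vorticities and $\|\rho\|_{1/2}=\|\mathcal A_2^{1/2}\rho\|_{L^2}$ for density fluctuations. Let $\gamma>-\frac12$ and let the forcing $f(\tau)\in D(\mathcal A_1^\gamma)$, $\tau\ge 0$, be locally integrable in time and have a time average $f_0\in D(\mathcal A_1^\gamma)$ in the following sense: there are $M>0$ and a function $\sigma$ with $\sigma(L)\to0$ as $L\to\infty$ such that for all $t\ge0$, $L>0$ $$\Big\|\mathcal A_1^\gamma\Big(\frac1L\int_t^{t+L}f(\tau)\,d\tau-f_0\Big)\Big\|_{L^2}\le\min(M,\sigma(L)).$$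 For $\varepsilon>0$ consider, in the fast time $\tau$, the oscillating system $$\omega_\tau+\varepsilon\mathcal A_1\omega+\varepsilon J(\omega,\Delta^{-1}\omega)=\varepsilon\rho_x+\varepsilon f(\tau),\qquad \rho_\tau+\varepsilon\mathcal A_2\rho+\varepsilon J(\rho,\Delta^{-1}\omega)=-\varepsilon N^2\Delta^{-1}\omega_x,$$ and the averaged system, for $(\bar\omega,\bar\rho)$, in which $f(\tau)$ is replaced by $f_0$. Solutions are continuous in time with values in $H^1_{per0}\times H^1_{per0}$ and satisfy the equations in the sense of distributions. Let $T>0$ and $R_0>0$ be arbitrary and fixed. Then there are $\varepsilon_0>0$ and a function $\eta^1_T$ with $\eta^1_T(\varepsilon)\to0$ as $\varepsilon\to0^+$ such that, for every $\varepsilon\in(0,\varepsilon_0)$ and every $S\in[0,T/\varepsilon]$, any solution $(\omega,\rho)$ of the oscillating system and any solution $(\bar\omega,\bar\rho)$ of the averaged system on $[0,S]$ with the same initial data $(\omega(0),\rho(0))=(\bar\omega(0),\bar\rho(0))$ in the ball $B_{\bf V}(R_0)$, that is, $\|\omega(0)\|_{1/2}+\|\rho(0)\|_{1/2}\le R_0$,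 satisfy $$\|\omega(\tau)-\bar\omega(\tau)\|_{1/2}+\|\rho(\tau)-\bar\rho(\tau)\|_{1/2}\le\eta^1_T(\varepsilon)\qquad\text{for all }\tau\in[0,S].$$ Here $R_0$ may in particular be the radius of an absorbing ball of the averaged system, and $S$ may be $T/\varepsilon$. -/

import Mathlib

open MeasureTheory Filter Topology

noncomputable section

namespace Thermohaline

/-! The measure on the circle `ℝ / ℤ` is the one with which Mathlib develops Fourier series on the
torus, the normalised Haar measure. -/
attribute [local instance] instMeasureSpaceUnitAddCircle

/-- The periodic domain `D`: the unit square with opposite sides identified.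
Coordinate `0` is `x`, coordinate `1` is `z`; its volume is the Lebesgue (probability) measure. -/
abbrev Torus := UnitAddTorus (Fin 2)

abbrev Freq := Fin 2 → ℤ

/-- Families of Fourier coefficients; they represent periodic distributions
`∑ k, c k * exp (2 π i k · x)`. -/
abbrev Coeffs := Freq → ℂ

/-- Real-valued square integrable functions on the periodic domain. -/
abbrev L2 := Lp ℝ 2 (volume : Measure Torus)

/-- The Fourier coefficients of a real-valued `L²` function. -/
def coeff (u : L2) : Coeffs :=
  fun k => UnitAddTorus.mFourierCoeff (fun x => ((u x : ℝ) : ℂ)) k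

/-- The eigenvalue `4 π² |k|²` of `-Δ` belonging to `exp (2 π i k · x)`. -/
def lam (k : Freq) : ℝ := 4 * Real.pi ^ 2 * ((k 0 : ℝ) ^ 2 + (k 1 : ℝ) ^ 2)

/-- `c` represents an element of `D(A^s)`, where `A = -κ Δ` (any `κ > 0`) acts on real periodic
distributions of mean zero. For `s = 0` this is `L²_per0`, for `s = 1/2` it is `H¹_per0`, and for
negative `s` it is a space of distributions (the completion of `L²_per0` in the norm
`‖A^s ·‖`). -/
structure MemDA (s : ℝ) (c : Coeffs) : Prop where
  mean_zero : c 0 = 0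
  real : ∀ k, c (-k) = (starRingEnd ℂ) (c k)
  summable : Summable fun k => (lam k ^ s * ‖c k‖) ^ 2

/-- The norm `‖A^s c‖` in `L²`, where `A = -κ Δ`. -/
def normDA (κ s : ℝ) (c : Coeffs) : ℝ :=
  Real.sqrt (∑' k, ((κ * lam k) ^ s * ‖c k‖) ^ 2)

/-- The (distributional) partial derivative in the direction of coordinate `j`. -/
def pderiv (j : Fin 2) (c : Coeffs) : Coeffs :=
  fun k => 2 * Real.pi * Complex.I * (k j : ℂ) * c k

/-- `Δ⁻¹` on mean-zero distributions. -/
def invLap (c : Coeffs) : Coeffs := fun k => -((lam k : ℂ))⁻¹ * c k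

/-- The `L²` function with (square summable) Fourier coefficients `c`. -/
def synth (c : Coeffs) : Lp ℂ 2 (volume : Measure Torus) :=
  ∑' k, c k • UnitAddTorus.mFourierLp 2 k

/-- The Jacobian `J(a, b) = a_x b_z - a_z b_x`, the pointwise product of the weak gradients, for
`a, b` with gradients in `L²`. It is an integrable function. -/
def jac (a b : Coeffs) : Torus → ℂ := fun x =>
  synth (pderiv 0 a) x * synth (pderiv 1 b) x - synth (pderiv 1 a) x * synth (pderiv 0 b) x

/-- `(ω, ρ)` is a solution on the time interval `[0, S]`, with values in
`V = H¹_per0 × H¹_per0` and continuous in time in the norm of `V`, of the system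
`ω_τ = ε (ν Δ ω - J(ω, Δ⁻¹ ω) + ρ_x + F(τ))`,
`ρ_τ = ε ((ν / Pr) Δ ρ - J(ρ, Δ⁻¹ ω) - N² Δ⁻¹ ω_x)`.
The equations hold in the sense of periodic distributions, integrated in time: they are tested
against every `exp (-2 π i k · x)`. -/
structure IsSolution (ν Pr N ε S : ℝ) (F : ℝ → Coeffs) (ω ρ : ℝ → L2) : Prop where
  mem_vorticity : ∀ τ ∈ Set.Icc 0 S, MemDA (1 / 2) (coeff (ω τ))
  mem_density : ∀ τ ∈ Set.Icc 0 S, MemDA (1 / 2) (coeff (ρ τ))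
  cont_vorticity : ∀ τ ∈ Set.Icc 0 S,
    Tendsto (fun s => normDA ν (1 / 2) (coeff (ω s) - coeff (ω τ))) (𝓝[Set.Icc 0 S] τ) (𝓝 0)
  cont_density : ∀ τ ∈ Set.Icc 0 S,
    Tendsto (fun s => normDA (ν / Pr) (1 / 2) (coeff (ρ s) - coeff (ρ τ)))
      (𝓝[Set.Icc 0 S] τ) (𝓝 0)
  eq_vorticity : ∀ τ ∈ Set.Icc 0 S, ∀ k,
    coeff (ω τ) k = coeff (ω 0) k + ε * ∫ s in (0 : ℝ)..τ,
      (-(ν * lam k : ℝ) * coeff (ω s) k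
        - UnitAddTorus.mFourierCoeff (jac (coeff (ω s)) (invLap (coeff (ω s)))) k
        + pderiv 0 (coeff (ρ s)) k + F s k)
  eq_density : ∀ τ ∈ Set.Icc 0 S, ∀ k,
    coeff (ρ τ) k = coeff (ρ 0) k + ε * ∫ s in (0 : ℝ)..τ,
      (-(ν / Pr * lam k : ℝ) * coeff (ρ s) k
        - UnitAddTorus.mFourierCoeff (jac (coeff (ρ s)) (invLap (coeff (ω s)))) k
        - (N : ℂ) ^ 2 * pderiv 0 (invLap (coeff (ω s))) k)

/-- The mean `(1 / L) ∫_t^{t + L} f(τ) dτ` of a family of distributions over a time window. -/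
def windowMean (f : ℝ → Coeffs) (t L : ℝ) : Coeffs :=
  fun k => ((1 / L : ℝ) : ℂ) * ∫ τ in t..(t + L), f τ k

/-- The forcing `f(τ)`, `τ ≥ 0`, with values in `D(A^γ)`, `A = -κ Δ`, has the time average
`f₀ ∈ D(A^γ)`: for all `t ≥ 0` and `L > 0`,
`‖A^γ ((1 / L) ∫_t^{t + L} f(τ) dτ - f₀)‖ ≤ min (M, σ(L))`, where `σ(L) → 0` as `L → ∞`. -/
structure HasTimeAverage (κ γ : ℝ) (f : ℝ → Coeffs) (f₀ : Coeffs) : Prop where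
  mem : ∀ τ, 0 ≤ τ → MemDA γ (f τ)
  mem_average : MemDA γ f₀
  integrable : ∀ k, ∀ b, 0 ≤ b → IntervalIntegrable (fun τ => f τ k) volume 0 b
  bound : ∃ M : ℝ, 0 < M ∧ ∃ σ : ℝ → ℝ, Tendsto σ atTop (𝓝 0) ∧
    ∀ t, 0 ≤ t → ∀ L, 0 < L →
      MemDA γ (windowMean f t L - f₀) ∧
      normDA κ γ (windowMean f t L - f₀) ≤ min M (σ L)

end Thermohaline

end

noncomputable section

namespace Thermohaline

/-! The unknowns are replaced by the coefficients `Ω`, `P` of `(-Δ)^(1/2) ω` and `(-Δ)^(1/2) ρ`, so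
that the `H¹` norm becomes, up to a constant, the norm of `SeqSpace`. In two dimensions `J(a, Δ⁻¹
b)` is bounded from `H¹ × H¹` to `L²` (`adv`, `norm_adv_apply_le`), since a vorticity in `H¹` gives
a velocity with absolutely summable coefficients. Diffusion then controls an `L²` source in `H¹`
(`sum_norm_sq_le_add_integral`).

The oscillation is isolated in a linear problem. Let `G` be the time integral of `f - f₀`. The heat
equation forced by `ε (f - f₀)` is integrated by parts in time, so that its solution `heatResponse`
involves only increments of `G`. The time average bounds `G t - G s` by `(t - s) (δ + C (t -
s)^(-r))` in `D(A^γ')`, with `δ` arbitrarily small. Heat smoothing from `D(A^γ')` to `D(A^(1/2))`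
costs `(ε L)^(-p)` with `p = 1/2 - γ'`, and `p < 1` because `γ > -1/2`; the singularity in time is
therefore integrable. For times up to `T / ε` the response is of order `δ + C ε^r`
(`eventually_finNorm_heatResponse_le`).

Averaged solutions stay bounded in `H¹` up to time `T / ε` (`exists_norm_bound`): after the
stationary response to `f₀` is subtracted, transport does no work in `L²`, the energy inequality
bounds the time integral of the squared `H¹` norm, and this integral is what a second Gronwall
argument in `H¹` needs.

Finally, the difference of the two solutions minus the linear response has only the difference of
the drifts as source. The drifts are Lipschitz on bounded sets, so Gronwall bounds the difference by
a multiple of the response; a bootstrap keeps the oscillating solution within distance one of the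
averaged one (`le_of_bootstrap`). -/

/-- Square summable families of Fourier coefficients. -/
abbrev SeqSpace := lp (fun _ : Freq => ℂ) 2

/-! ### Square summable sequences and shifted multipliers -/

lemma memlp_iff_summable {c : Coeffs} : Memℓp c 2 ↔ Summable fun k => ‖c k‖ ^ 2 := by
  rw [memℓp_gen_iff (by norm_num)]; simp

lemma hasSum_norm_sq (a : SeqSpace) : HasSum (fun k => ‖a k‖ ^ 2) (‖a‖ ^ 2) := by
  simpa using lp.hasSum_norm (p := 2) (by norm_num) a

lemma norm_le_of_forall_sum_sq_le {a : SeqSpace} {C : ℝ} (hC : 0 ≤ C)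
    (h : ∀ K : Finset Freq, ∑ k ∈ K, ‖a k‖ ^ 2 ≤ C ^ 2) : ‖a‖ ≤ C := by
  refine lp.norm_le_of_forall_sum_le (p := 2) (by norm_num) hC fun K => ?_
  simpa using h K

lemma sum_norm_sq_le (a : SeqSpace) (K : Finset Freq) : ∑ k ∈ K, ‖a k‖ ^ 2 ≤ ‖a‖ ^ 2 :=
  sum_le_hasSum K (fun _ _ => sq_nonneg _) (hasSum_norm_sq a)

/-- The operator which shifts by `j` and then multiplies by a bounded symbol `q`. -/
def shiftMul (q : Freq → ℂ) (C : ℝ) (hq : ∀ k, ‖q k‖ ≤ C) (j : Freq) :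
    SeqSpace →L[ℂ] SeqSpace :=
  have hC : 0 ≤ C := (norm_nonneg _).trans (hq 0)
  have hsum : ∀ a : SeqSpace, HasSum (fun k => C ^ 2 * ‖a (k - j)‖ ^ 2) (C ^ 2 * ‖a‖ ^ 2) :=
    fun a => ((Equiv.subRight j).hasSum_iff.2 (hasSum_norm_sq a)).mul_left (C ^ 2)
  have hle : ∀ (a : SeqSpace) k, ‖q k * a (k - j)‖ ^ 2 ≤ C ^ 2 * ‖a (k - j)‖ ^ 2 := fun a k => by
    rw [norm_mul, mul_pow]; gcongr; exact hq k
  LinearMap.mkContinuous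
    { toFun := fun a => ⟨fun k => q k * a (k - j), memlp_iff_summable.2
        ((hsum a).summable.of_nonneg_of_le (fun _ => sq_nonneg _) (hle a))⟩
      map_add' := fun a b => by ext k; simp [mul_add]; rfl
      map_smul' := fun c a => by ext k; simp [mul_left_comm] } C fun a => by
    refine norm_le_of_forall_sum_sq_le (mul_nonneg hC (norm_nonneg _)) fun K => ?_
    rw [mul_pow]
    exact (Finset.sum_le_sum fun k _ => hle a k).trans
      (sum_le_hasSum K (fun _ _ => by positivity) (hsum a))

@[simp] lemma shiftMul_apply (q : Freq → ℂ) (C : ℝ) (hq : ∀ k, ‖q k‖ ≤ C) (j : Freq)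
    (a : SeqSpace) (k : Freq) : shiftMul q C hq j a k = q k * a (k - j) := rfl

lemma norm_shiftMul_le (q : Freq → ℂ) (C : ℝ) (hq : ∀ k, ‖q k‖ ≤ C) (j : Freq) :
    ‖shiftMul q C hq j‖ ≤ C := by
  unfold shiftMul
  exact LinearMap.mkContinuous_norm_le _ ((norm_nonneg _).trans (hq 0)) _

/-! ### The eigenvalues -/

lemma lam_nonneg (k : Freq) : 0 ≤ lam k := by unfold lam; positivity

@[simp] lemma lam_zero : lam 0 = 0 := by simp [lam]

@[simp] lemma lam_neg (k : Freq) : lam (-k) = lam k := by simp [lam]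

lemma norm_sq_le_lam (k : Freq) : ‖k‖ ^ 2 ≤ lam k := by
  have hpi : 1 ≤ 4 * Real.pi ^ 2 := by nlinarith [Real.pi_gt_three]
  have hs : 0 ≤ (k 0 : ℝ) ^ 2 + (k 1 : ℝ) ^ 2 := by positivity
  have h : ‖k‖ ≤ Real.sqrt (lam k) := by
    refine (pi_norm_le_iff_of_nonneg (Real.sqrt_nonneg _)).2 fun i => ?_
    refine Real.le_sqrt_of_sq_le ?_
    have : ‖k i‖ ^ 2 = (k i : ℝ) ^ 2 := by rw [Int.norm_eq_abs, sq_abs]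
    rw [this]
    have hi : (k i : ℝ) ^ 2 ≤ (k 0 : ℝ) ^ 2 + (k 1 : ℝ) ^ 2 := by
      fin_cases i
      · simpa using sq_nonneg _
      · simpa using sq_nonneg _
    unfold lam; nlinarith
  calc ‖k‖ ^ 2 ≤ Real.sqrt (lam k) ^ 2 := by gcongr
    _ = lam k := Real.sq_sqrt (lam_nonneg k)

lemma one_le_lam {k : Freq} (hk : k ≠ 0) : 1 ≤ lam k := by
  refine le_trans ?_ (norm_sq_le_lam k)
  have : 1 ≤ ‖k‖ := by
    obtain ⟨i, hi⟩ := Function.ne_iff.1 hk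
    refine le_trans ?_ (norm_le_pi_norm k i)
    rw [Int.norm_eq_abs]; exact_mod_cast Int.one_le_abs hi
  nlinarith

lemma lam_pos {k : Freq} (hk : k ≠ 0) : 0 < lam k := one_pos.trans_le (one_le_lam hk)

lemma one_le_sqrt_lam {k : Freq} (hk : k ≠ 0) : 1 ≤ √(lam k) := by
  rw [← Real.sqrt_one]; exact Real.sqrt_le_sqrt (one_le_lam hk)

/-- Comparison with `∑ ‖k‖⁻⁴`, which converges on a two-dimensional lattice; the term at `k = 0` is
`0` because `0⁻¹ = 0`. -/
lemma summable_inv_lam_sq : Summable fun k : Freq => ((lam k)⁻¹) ^ 2 := by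
  have h := EisensteinSeries.summable_one_div_norm_rpow (k := 4) (by norm_num)
  refine h.of_nonneg_of_le (fun _ => by positivity) fun k => ?_
  rcases eq_or_ne k 0 with rfl | hk
  · simp
  have h0 : 0 < ‖k‖ := norm_pos_iff.2 hk
  rw [show (-4 : ℝ) = -((4 : ℕ) : ℝ) by norm_num, Real.rpow_neg h0.le, Real.rpow_natCast,
    inv_pow]
  refine inv_anti₀ (by positivity) ?_
  calc ‖k‖ ^ 4 = (‖k‖ ^ 2) ^ 2 := by ring
    _ ≤ lam k ^ 2 := by gcongr; exact norm_sq_le_lam k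

/-! ### Fourier multipliers -/

/-- Multiplication by `λ_k ^ (-1/2)`. -/
def invSqrtLap : SeqSpace →L[ℂ] SeqSpace :=
  shiftMul (fun k => ((√(lam k))⁻¹ : ℝ)) 1 (fun k => by
    rw [Complex.norm_real, Real.norm_of_nonneg (by positivity)]
    -- At `k = 0` the symbol is `0⁻¹ = 0`: the multiplier discards the mean.
    rcases eq_or_ne k 0 with rfl | hk
    · simp
    · exact inv_le_one_of_one_le₀ (one_le_sqrt_lam hk)) 0

@[simp] lemma invSqrtLap_apply (a : SeqSpace) (k : Freq) :
    invSqrtLap a k = ((√(lam k))⁻¹ : ℝ) * a k := by simp [invSqrtLap]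

lemma norm_invSqrtLap_apply_le (a : SeqSpace) : ‖invSqrtLap a‖ ≤ ‖a‖ := by
  simpa using invSqrtLap.le_of_opNorm_le (norm_shiftMul_le ..) a

lemma norm_pderiv_symbol_le (i : Fin 2) (k : Freq) :
    ‖2 * Real.pi * Complex.I * (k i : ℂ)‖ ≤ √(lam k) := by
  refine Real.le_sqrt_of_sq_le ?_
  simp only [norm_mul, Complex.norm_ofNat, Complex.norm_real, Complex.norm_I, mul_one, mul_pow,
    Complex.norm_intCast, sq_abs, Real.norm_eq_abs]
  have hi : (k i : ℝ) ^ 2 ≤ (k 0 : ℝ) ^ 2 + (k 1 : ℝ) ^ 2 := by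
    fin_cases i
    · simpa using sq_nonneg _
    · simpa using sq_nonneg _
  unfold lam
  nlinarith [sq_nonneg Real.pi]

/-- The symbol of `∂ₓ (-Δ)^(-1/2)`. -/
def derivX : SeqSpace →L[ℂ] SeqSpace :=
  shiftMul (fun k => 2 * Real.pi * Complex.I * (k 0 : ℂ) * ((√(lam k))⁻¹ : ℝ)) 1 (fun k => by
    rw [norm_mul, Complex.norm_real, Real.norm_of_nonneg (by positivity), ← div_eq_mul_inv]
    exact div_le_one_of_le₀ (norm_pderiv_symbol_le 0 k) (Real.sqrt_nonneg _)) 0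

@[simp] lemma derivX_apply (a : SeqSpace) (k : Freq) :
    derivX a k = 2 * Real.pi * Complex.I * (k 0 : ℂ) * ((√(lam k))⁻¹ : ℝ) * a k := by
  simp [derivX]

lemma norm_derivX_apply_le (a : SeqSpace) : ‖derivX a‖ ≤ ‖a‖ := by
  simpa using derivX.le_of_opNorm_le (norm_shiftMul_le ..) a

lemma inv_lam_le_one (k : Freq) : (lam k)⁻¹ ≤ 1 := by
  rcases eq_or_ne k 0 with rfl | hk
  · simp
  · exact inv_le_one_of_one_le₀ (one_le_lam hk)

/-- Multiplication by `λ_k ^ (-1)`. -/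
def invNegLap : SeqSpace →L[ℂ] SeqSpace :=
  shiftMul (fun k => ((lam k)⁻¹ : ℝ)) 1 (fun k => by
    rw [Complex.norm_real, Real.norm_of_nonneg (inv_nonneg.2 (lam_nonneg k))]
    exact inv_lam_le_one k) 0

@[simp] lemma invNegLap_apply (a : SeqSpace) (k : Freq) :
    invNegLap a k = ((lam k)⁻¹ : ℝ) * a k := by simp [invNegLap]

lemma norm_invNegLap_apply_le (a : SeqSpace) : ‖invNegLap a‖ ≤ ‖a‖ := by
  simpa using invNegLap.le_of_opNorm_le (norm_shiftMul_le ..) a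

/-- The symbol of `∂ₓ (-Δ)^(-3/2)`. -/
def derivXInvLap : SeqSpace →L[ℂ] SeqSpace := invNegLap ∘L derivX

@[simp] lemma derivXInvLap_apply (a : SeqSpace) (k : Freq) :
    derivXInvLap a k =
      ((lam k)⁻¹ : ℝ) * (2 * Real.pi * Complex.I * (k 0 : ℂ) * ((√(lam k))⁻¹ : ℝ) * a k) := by
  simp [derivXInvLap]

lemma norm_derivXInvLap_apply_le (a : SeqSpace) : ‖derivXInvLap a‖ ≤ ‖a‖ :=
  (norm_invNegLap_apply_le _).trans (norm_derivX_apply_le a)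

/-! ### Advection -/

/-- The determinant `j₀ k₁ - j₁ k₀`. -/
def cross (j k : Freq) : ℝ := j 0 * k 1 - j 1 * k 0

lemma cross_sub_self (j k : Freq) : cross j (k - j) = cross j k := by
  simp [cross]; ring

lemma cross_neg_left (j k : Freq) : cross (-j) k = -cross j k := by
  simp [cross]; ring

lemma abs_cross_le (j k : Freq) : 4 * Real.pi ^ 2 * |cross j k| ≤ √(lam j) * √(lam k) := by
  rw [← Real.sqrt_mul (lam_nonneg j)]
  refine Real.le_sqrt_of_sq_le ?_
  rw [mul_pow, sq_abs]
  have : lam j * lam k = (4 * Real.pi ^ 2) ^ 2 * (((j 0 : ℝ) ^ 2 + (j 1 : ℝ) ^ 2) *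
      ((k 0 : ℝ) ^ 2 + (k 1 : ℝ) ^ 2)) := by unfold lam; ring
  rw [this]
  gcongr
  unfold cross
  -- Lagrange's identity: `|j|² |k|²` is the square of the determinant plus the square of the scalar
  -- product.
  nlinarith [sq_nonneg ((j 0 : ℝ) * k 0 + (j 1 : ℝ) * k 1)]

/-- The symbol of the interaction of the frequency `j` of the transporting vorticity with the
frequency `k - j` of the transported quantity. -/
def advSymbol (j k : Freq) : ℝ :=
  -(4 * Real.pi ^ 2) * cross j k * ((lam j)⁻¹ * (√(lam j))⁻¹) * (√(lam (k - j)))⁻¹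

/-- The determinant does not change when `k` is replaced by `k - j`, and is then absorbed by the
weights `λ_j^(-1/2)` and `λ_(k-j)^(-1/2)`. The remaining factor is square summable in `j`, which
makes `adv` bounded. -/
lemma norm_advSymbol_le (j k : Freq) : ‖(advSymbol j k : ℂ)‖ ≤ (lam j)⁻¹ := by
  rw [Complex.norm_real, Real.norm_eq_abs]
  have hj := lam_nonneg j
  have h : |advSymbol j k| = (lam j)⁻¹ *
      (4 * Real.pi ^ 2 * |cross j (k - j)| / (√(lam j) * √(lam (k - j)))) := by
    unfold advSymbol
    rw [cross_sub_self, abs_mul, abs_mul, abs_mul, abs_neg, abs_of_nonneg (by positivity :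
      (0:ℝ) ≤ 4 * Real.pi ^ 2), abs_of_nonneg (by positivity : (0:ℝ) ≤ (√(lam (k - j)))⁻¹),
      abs_of_nonneg (by positivity : 0 ≤ (lam j)⁻¹ * (√(lam j))⁻¹), div_eq_mul_inv, mul_inv]
    ring
  rw [h]
  exact mul_le_of_le_one_right (inv_nonneg.2 hj)
    (div_le_one_of_le₀ (abs_cross_le _ _) (by positivity))

/-- Transport by the velocity field of the frequency `j`. -/
def advMode (j : Freq) : SeqSpace →L[ℂ] SeqSpace :=
  shiftMul (fun k => advSymbol j k) (lam j)⁻¹ (norm_advSymbol_le j) j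

lemma summable_mul_of_sq {x y : Freq → ℝ} (hx : Summable fun k => x k ^ 2)
    (hy : Summable fun k => y k ^ 2) (hx0 : ∀ k, 0 ≤ x k) (hy0 : ∀ k, 0 ≤ y k) :
    Summable (fun k => x k * y k) ∧
      ∑' k, x k * y k ≤ √(∑' k, x k ^ 2) * √(∑' k, y k ^ 2) := by
  have := Real.summable_and_inner_le_Lp_mul_Lq_tsum_of_nonneg (p := 2) (q := 2)
    Real.HolderConjugate.two_two hx0 hy0 (by simpa using hx) (by simpa using hy)
  simpa [Real.sqrt_eq_rpow] using this

/-- The norm of the embedding of `H³` into the functions with absolutely convergent gradient. -/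
def advConst : ℝ := √(∑' k : Freq, ((lam k)⁻¹) ^ 2)

lemma advConst_nonneg : 0 ≤ advConst := Real.sqrt_nonneg _

lemma norm_smul_advMode_le (b : SeqSpace) (j : Freq) :
    ‖b j • advMode j‖ ≤ ‖b j‖ * (lam j)⁻¹ := by
  rw [norm_smul]; gcongr; exact norm_shiftMul_le ..

lemma summable_norm_mul_inv_lam (b : SeqSpace) :
    Summable (fun j => ‖b j‖ * (lam j)⁻¹) ∧ ∑' j, ‖b j‖ * (lam j)⁻¹ ≤ advConst * ‖b‖ := by
  have h := summable_mul_of_sq (hasSum_norm_sq b).summable summable_inv_lam_sq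
    (fun _ => norm_nonneg _) (fun k => inv_nonneg.2 (lam_nonneg k))
  refine ⟨h.1, h.2.trans_eq ?_⟩
  rw [(hasSum_norm_sq b).tsum_eq, Real.sqrt_sq (norm_nonneg _), mul_comm, advConst]

lemma summable_smul_advMode (b : SeqSpace) : Summable fun j => b j • advMode j :=
  .of_norm_bounded (summable_norm_mul_inv_lam b).1 (norm_smul_advMode_le b)

/-- `adv b a` is `J(a, Δ⁻¹ b)`, where `a` and `b` are given by the coefficients of `(-Δ)^(1/2) a`
and of `(-Δ)^(1/2) b`. -/
def adv : SeqSpace →L[ℂ] SeqSpace →L[ℂ] SeqSpace :=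
  LinearMap.mkContinuous
    { toFun := fun b => ∑' j, b j • advMode j
      map_add' := fun b c => by
        rw [← (summable_smul_advMode b).tsum_add (summable_smul_advMode c)]
        simp [add_smul]
      map_smul' := fun r b => by
        rw [RingHom.id_apply, ← (summable_smul_advMode b).tsum_const_smul]
        simp [smul_smul] } advConst fun b => by
    refine (norm_tsum_le_tsum_norm
      ((summable_norm_mul_inv_lam b).1.of_nonneg_of_le (fun _ => norm_nonneg _)
        (norm_smul_advMode_le b))).trans ?_
    refine le_trans (Summable.tsum_le_tsum (norm_smul_advMode_le b) ?_
      (summable_norm_mul_inv_lam b).1) (summable_norm_mul_inv_lam b).2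
    exact (summable_norm_mul_inv_lam b).1.of_nonneg_of_le (fun _ => norm_nonneg _)
        (norm_smul_advMode_le b)

lemma norm_adv_apply_le (a b : SeqSpace) : ‖adv b a‖ ≤ advConst * ‖b‖ * ‖a‖ := by
  refine (adv b).le_of_opNorm_le ?_ a
  exact adv.le_of_opNorm_le (LinearMap.mkContinuous_norm_le _ advConst_nonneg _) b

lemma adv_eq_tsum (b : SeqSpace) : adv b = ∑' j, b j • advMode j := rfl

lemma hasSum_adv (a b : SeqSpace) : HasSum (fun j => b j • advMode j a) (adv b a) := by
  have h := (ContinuousLinearMap.apply ℂ SeqSpace a).hasSum (summable_smul_advMode b).hasSum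
  rw [adv_eq_tsum]
  simpa only [ContinuousLinearMap.apply_apply, smul_apply] using h

lemma hasSum_adv_apply (a b : SeqSpace) (k : Freq) :
    HasSum (fun j => b j * ((advSymbol j k : ℂ) * a (k - j))) (adv b a k) :=
  (lp.evalCLM ℂ (fun _ : Freq => ℂ) 2 k).hasSum (hasSum_adv a b)

/-- The substitution `k ↦ k - j` moves the shift onto the other factor. The determinant is invariant
under it, because each Fourier mode of the velocity is divergence free, and odd in `j`, which
produces the sign. -/
lemma inner_advMode_neg (a : SeqSpace) (j : Freq) :
    inner ℂ (invSqrtLap a) (advMode (-j) a) =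
      -(starRingEnd ℂ) (inner ℂ (invSqrtLap a) (advMode j a)) := by
  rw [lp.inner_eq_tsum, lp.inner_eq_tsum, Complex.conj_tsum, ← tsum_neg,
    ← (Equiv.subRight j).tsum_eq]
  congr 1
  ext k
  simp only [Equiv.subRight_apply, invSqrtLap_apply, advMode, shiftMul_apply, advSymbol,
    RCLike.inner_apply, map_mul, Complex.conj_ofReal, cross_neg_left, lam_neg, cross_sub_self,
    sub_neg_eq_add, sub_add_cancel, Complex.conj_conj]
  push_cast
  ring

/-- Transport by a real divergence free field conserves the `L²` norm. -/
lemma re_inner_adv_eq_zero (a b : SeqSpace) (hb : ∀ k, b (-k) = (starRingEnd ℂ) (b k)) :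
    (inner ℂ (invSqrtLap a) (adv b a)).re = 0 := by
  have h : HasSum (fun j => b j * inner ℂ (invSqrtLap a) (advMode j a))
      (inner ℂ (invSqrtLap a) (adv b a)) := by
    simpa [inner_smul_right] using (innerSL ℂ (invSqrtLap a)).hasSum (hasSum_adv a b)
  -- After reindexing by `j ↦ -j`, the reality of `b` and `inner_advMode_neg` make the sum equal to
  -- minus its own conjugate.
  have h2 := (Equiv.neg Freq).hasSum_iff.2 h
  have h3 : HasSum (fun j => -(starRingEnd ℂ) (b j * inner ℂ (invSqrtLap a) (advMode j a)))
      (-(starRingEnd ℂ) (inner ℂ (invSqrtLap a) (adv b a))) :=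
    ((Complex.hasSum_conj' ..).2 h).neg
  have h4 := h2.unique (by
    convert h3 using 2 with j
    simp only [Function.comp_apply, Equiv.neg_apply, hb, inner_advMode_neg, map_mul]
    ring)
  have := congrArg Complex.re h4
  simp only [Complex.neg_re, Complex.conj_re] at this
  linarith

attribute [local instance] instMeasureSpaceUnitAddCircle
attribute [local instance] instIsProbabilityMeasureUnitAddCircleVolume

/-! ### Fourier series of products -/

lemma mFourierCoeff_synth {c : Coeffs} (hc : Memℓp c 2) (k : Freq) :
    UnitAddTorus.mFourierCoeff (synth c) k = c k := by
  have h := UnitAddTorus.mFourierBasis.hasSum_repr_symm (⟨c, hc⟩ : SeqSpace)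
  have h2 : synth c = UnitAddTorus.mFourierBasis.repr.symm (⟨c, hc⟩ : SeqSpace) := by
    rw [UnitAddTorus.coe_mFourierBasis] at h
    exact h.tsum_eq
  rw [← UnitAddTorus.mFourierBasis_repr, h2, LinearIsometryEquiv.apply_symm_apply]

/-- Parseval's identity for `G` and the conjugate of `F` times the `k`-th exponential, which is
still in `L²`. -/
lemma hasSum_mFourierCoeff_mul (F G : Lp ℂ 2 (volume : Measure Torus)) (k : Freq) :
    HasSum (fun j => UnitAddTorus.mFourierCoeff G j * UnitAddTorus.mFourierCoeff F (k - j))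
      (UnitAddTorus.mFourierCoeff (fun x => F x * G x) k) := by
  have hH : MemLp (fun x => (starRingEnd ℂ) (F x) * UnitAddTorus.mFourier k x) 2
      (volume : Measure Torus) := by
    refine (Lp.memLp F).of_le ?_ (Eventually.of_forall fun x => ?_)
    · exact (Complex.continuous_conj.comp_aestronglyMeasurable
        (Lp.aestronglyMeasurable F)).mul
        (UnitAddTorus.mFourier k).continuous.aestronglyMeasurable
    · rw [norm_mul, RCLike.norm_conj]
      refine mul_le_of_le_one_right (norm_nonneg _) ?_
      exact ((UnitAddTorus.mFourier k).norm_coe_le_norm x).trans_eq UnitAddTorus.mFourier_norm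
  have h := UnitAddTorus.hasSum_prod_mFourierCoeff hH.toLp G
  convert h using 1
  · ext j
    rw [mul_comm]
    congr 1
    unfold UnitAddTorus.mFourierCoeff
    rw [← integral_conj]
    refine integral_congr_ae ?_
    filter_upwards [hH.coeFn_toLp] with x hx
    rw [hx]
    simp only [smul_eq_mul, map_mul, Complex.conj_conj, ← UnitAddTorus.mFourier_neg, neg_neg]
    rw [show -(k - j) = j + -k by abel, UnitAddTorus.mFourier_add]
    ring
  · unfold UnitAddTorus.mFourierCoeff
    refine integral_congr_ae ?_
    filter_upwards [hH.coeFn_toLp] with x hx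
    rw [hx]
    simp only [smul_eq_mul, map_mul, Complex.conj_conj, ← UnitAddTorus.mFourier_neg]
    ring

lemma mFourierCoeff_sub {f g : Torus → ℂ} (hf : Integrable f) (hg : Integrable g) (k : Freq) :
    UnitAddTorus.mFourierCoeff (fun x => f x - g x) k =
      UnitAddTorus.mFourierCoeff f k - UnitAddTorus.mFourierCoeff g k := by
  have h : ∀ {f : Torus → ℂ}, Integrable f →
      Integrable fun x => UnitAddTorus.mFourier (-k) x • f x := fun hf =>
    hf.bdd_mul (c := 1) (UnitAddTorus.mFourier (-k)).continuous.aestronglyMeasurable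
      (Eventually.of_forall fun x =>
        ((UnitAddTorus.mFourier (-k)).norm_coe_le_norm x).trans_eq UnitAddTorus.mFourier_norm)
  unfold UnitAddTorus.mFourierCoeff
  rw [← integral_sub (h hf) (h hg)]
  simp only [smul_sub]

lemma integrable_synth_mul (a b : Coeffs) : Integrable fun x => synth a x * synth b x :=
  (Lp.memLp (synth a)).integrable_mul (Lp.memLp (synth b))

lemma coeff_sub (u v : L2) : coeff (u - v) = coeff u - coeff v := by
  have hint : ∀ u : L2, Integrable fun x => ((u x : ℝ) : ℂ) := fun u =>
    ((Lp.memLp u).integrable (by norm_num)).ofReal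
  ext k
  rw [Pi.sub_apply]
  unfold coeff
  rw [← mFourierCoeff_sub (hint u) (hint v)]
  refine integral_congr_ae ?_
  filter_upwards [Lp.coeFn_sub u v] with x hx
  rw [hx, Pi.sub_apply, Complex.ofReal_sub]

/-! ### The space `H¹` -/

lemma MemDA.memlp_half {c : Coeffs} (h : MemDA (1 / 2) c) :
    Memℓp (fun k => (√(lam k) : ℂ) * c k) 2 := by
  rw [memlp_iff_summable]
  convert h.summable using 2 with k
  rw [norm_mul, Complex.norm_real, Real.norm_of_nonneg (Real.sqrt_nonneg _), Real.sqrt_eq_rpow]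

open Classical in
/-- The coefficients of `(-Δ)^(1/2) c`. -/
def sqrtLap (c : Coeffs) : SeqSpace :=
  if h : Memℓp (fun k => (√(lam k) : ℂ) * c k) 2 then ⟨_, h⟩ else 0

lemma MemDA.sqrtLap_apply {c : Coeffs} (h : MemDA (1 / 2) c) (k : Freq) :
    sqrtLap c k = (√(lam k) : ℂ) * c k := by
  unfold sqrtLap
  rw [dif_pos h.memlp_half]

lemma MemDA.eq_inv_mul {c : Coeffs} (h : MemDA (1 / 2) c) (k : Freq) :
    c k = ((√(lam k))⁻¹ : ℝ) * sqrtLap c k := by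
  rw [h.sqrtLap_apply]
  rcases eq_or_ne k 0 with rfl | hk
  · simp [h.mean_zero]
  · have : (√(lam k) : ℂ) ≠ 0 := by
      exact_mod_cast (Real.sqrt_pos.2 (lam_pos hk)).ne'
    push_cast
    field_simp

lemma MemDA.sqrtLap_neg {c : Coeffs} (h : MemDA (1 / 2) c) (k : Freq) :
    sqrtLap c (-k) = (starRingEnd ℂ) (sqrtLap c k) := by
  rw [h.sqrtLap_apply, h.sqrtLap_apply, h.real, lam_neg, map_mul, Complex.conj_ofReal]

lemma MemDA.sub {c d : Coeffs} (hc : MemDA (1 / 2) c) (hd : MemDA (1 / 2) d) :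
    MemDA (1 / 2) (c - d) where
  mean_zero := by simp [hc.mean_zero, hd.mean_zero]
  real k := by simp [hc.real, hd.real]
  summable := by
    have := memlp_iff_summable.1 (hc.memlp_half.sub hd.memlp_half)
    convert this using 2 with k
    rw [Pi.sub_apply, Pi.sub_apply, ← mul_sub, norm_mul, Complex.norm_real,
      Real.norm_of_nonneg (Real.sqrt_nonneg _), Real.sqrt_eq_rpow]

lemma MemDA.sqrtLap_sub {c d : Coeffs} (hc : MemDA (1 / 2) c) (hd : MemDA (1 / 2) d) :
    sqrtLap (c - d) = sqrtLap c - sqrtLap d := by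
  ext k
  simp [hc.sqrtLap_apply, hd.sqrtLap_apply, (hc.sub hd).sqrtLap_apply, mul_sub]

lemma MemDA.normDA_half {c : Coeffs} (h : MemDA (1 / 2) c) {κ : ℝ} (hκ : 0 < κ) :
    normDA κ (1 / 2) c = √κ * ‖sqrtLap c‖ := by
  unfold normDA
  rw [← Real.sqrt_sq (norm_nonneg (sqrtLap c)), ← Real.sqrt_mul hκ.le]
  congr 1
  refine HasSum.tsum_eq ?_
  convert! (hasSum_norm_sq (sqrtLap c)).mul_left κ using 2 with k
  rw [h.sqrtLap_apply, ← Real.sqrt_eq_rpow, norm_mul, Complex.norm_real,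
    Real.norm_of_nonneg (Real.sqrt_nonneg _), mul_pow, mul_pow,
    Real.sq_sqrt (mul_nonneg hκ.le (lam_nonneg k)), Real.sq_sqrt (lam_nonneg k), mul_assoc]

lemma MemDA.memlp_pderiv {c : Coeffs} (h : MemDA (1 / 2) c) (i : Fin 2) :
    Memℓp (pderiv i c) 2 := by
  rw [memlp_iff_summable]
  refine (memlp_iff_summable.1 h.memlp_half).of_nonneg_of_le (fun _ => sq_nonneg _) fun k => ?_
  unfold pderiv
  rw [norm_mul, norm_mul (√(lam k) : ℂ), Complex.norm_real,
    Real.norm_of_nonneg (Real.sqrt_nonneg _)]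
  gcongr
  exact norm_pderiv_symbol_le i k

lemma MemDA.memlp_pderiv_invLap {c : Coeffs} (h : MemDA (1 / 2) c) (i : Fin 2) :
    Memℓp (pderiv i (invLap c)) 2 := by
  rw [memlp_iff_summable]
  refine (memlp_iff_summable.1 (h.memlp_pderiv i)).of_nonneg_of_le (fun _ => sq_nonneg _)
    fun k => ?_
  have : pderiv i (invLap c) k = -((lam k)⁻¹ : ℝ) * pderiv i c k := by
    simp only [pderiv, invLap]; push_cast; ring
  rw [this, norm_mul]
  gcongr
  refine mul_le_of_le_one_left (norm_nonneg _) ?_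
  rw [norm_neg, Complex.norm_real, Real.norm_of_nonneg (inv_nonneg.2 (lam_nonneg k))]
  exact inv_lam_le_one k

/-- The bridge from pointwise products of gradients to the operator `adv`. Both products become
convolutions; `(2πi)²` and the sign of `Δ⁻¹` combine with the determinant to give `advSymbol`. -/
lemma mFourierCoeff_jac {a b : Coeffs} (ha : MemDA (1 / 2) a) (hb : MemDA (1 / 2) b) (k : Freq) :
    UnitAddTorus.mFourierCoeff (jac a (invLap b)) k = adv (sqrtLap b) (sqrtLap a) k := by
  unfold jac
  rw [mFourierCoeff_sub (integrable_synth_mul _ _) (integrable_synth_mul _ _)]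
  refine HasSum.unique ?_ (hasSum_adv_apply (sqrtLap a) (sqrtLap b) k)
  convert! (hasSum_mFourierCoeff_mul (synth (pderiv 0 a)) (synth (pderiv 1 (invLap b))) k).sub
    (hasSum_mFourierCoeff_mul (synth (pderiv 1 a)) (synth (pderiv 0 (invLap b))) k) using 2 with j
  rw [mFourierCoeff_synth (ha.memlp_pderiv 0), mFourierCoeff_synth (ha.memlp_pderiv 1),
    mFourierCoeff_synth (hb.memlp_pderiv_invLap 0), mFourierCoeff_synth (hb.memlp_pderiv_invLap 1)]
  simp only [pderiv, invLap]
  rw [ha.eq_inv_mul (k - j), hb.eq_inv_mul j]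
  unfold advSymbol cross
  simp only [Pi.sub_apply]
  push_cast
  ring_nf
  simp only [Complex.I_sq]
  ring

/-! ### The equations for the Fourier modes -/

/-- The part of the vorticity equation without diffusion and forcing. -/
def vorticityDrift (Ω P : SeqSpace) : SeqSpace := -adv Ω Ω + derivX P

/-- The part of the density equation without diffusion. -/
def densityDrift (N : ℝ) (Ω P : SeqSpace) : SeqSpace :=
  -adv Ω P + ((N ^ 2 : ℝ) : ℂ) • derivXInvLap Ω

/-- The equations for `Ω = (-Δ)^(1/2) ω` and `P = (-Δ)^(1/2) ρ`. -/
structure IsModeSolution (ν μ N ε S : ℝ) (F : ℝ → Coeffs) (Ω P : ℝ → SeqSpace) : Prop where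
  cont_vorticity : Continuous Ω
  cont_density : Continuous P
  zero_vorticity : ∀ τ, Ω τ 0 = 0
  zero_density : ∀ τ, P τ 0 = 0
  real_vorticity : ∀ τ k, Ω τ (-k) = (starRingEnd ℂ) (Ω τ k)
  -- The force has an integral of its own, apart from the other terms, whose integrand is continuous
  -- in time.
  eq_vorticity : ∀ τ ∈ Set.Icc 0 S, ∀ k,
    Ω τ k = Ω 0 k + (∫ s in (0 : ℝ)..τ, (ε : ℂ) *
      (-(ν * lam k : ℝ) * Ω s k + (√(lam k) : ℂ) * vorticityDrift (Ω s) (P s) k))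
      + ε * (√(lam k) : ℂ) * ∫ s in (0 : ℝ)..τ, F s k
  eq_density : ∀ τ ∈ Set.Icc 0 S, ∀ k,
    P τ k = P 0 k + ∫ s in (0 : ℝ)..τ, (ε : ℂ) *
      (-(μ * lam k : ℝ) * P s k + (√(lam k) : ℂ) * densityDrift N (Ω s) (P s) k)

lemma continuous_eval {Y : ℝ → SeqSpace} (hY : Continuous Y) (k : Freq) :
    Continuous fun s => Y s k :=
  (lp.evalCLM ℂ (fun _ : Freq => ℂ) 2 k).continuous.comp hY

lemma Continuous.vorticityDrift {Ω P : ℝ → SeqSpace} (hΩ : Continuous Ω) (hP : Continuous P) :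
    Continuous fun s => vorticityDrift (Ω s) (P s) := by
  unfold Thermohaline.vorticityDrift
  exact ((adv.continuous.comp hΩ).clm_apply hΩ).neg.add (derivX.continuous.comp hP)

lemma Continuous.densityDrift {Ω P : ℝ → SeqSpace} (N : ℝ) (hΩ : Continuous Ω)
    (hP : Continuous P) : Continuous fun s => densityDrift N (Ω s) (P s) := by
  unfold Thermohaline.densityDrift
  exact ((adv.continuous.comp hΩ).clm_apply hP).neg.add
    ((derivXInvLap.continuous.comp hΩ).const_smul ((N ^ 2 : ℝ) : ℂ))

lemma sqrt_lam_mul_cancel (k : Freq) (z : ℂ) :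
    (√(lam k) : ℂ) * ((lam k : ℂ) * (((√(lam k))⁻¹ : ℝ) * z)) = lam k * z := by
  rcases eq_or_ne k 0 with rfl | hk
  · simp
  · have : (√(lam k) : ℂ) ≠ 0 := by
      exact_mod_cast (Real.sqrt_pos.2 (lam_pos hk)).ne'
    push_cast
    field_simp

lemma continuousOn_sqrtLap {κ S : ℝ} (hκ : 0 < κ) {u : ℝ → L2}
    (hmem : ∀ τ ∈ Set.Icc 0 S, MemDA (1 / 2) (coeff (u τ)))
    (hcont : ∀ τ ∈ Set.Icc 0 S, Tendsto (fun s => normDA κ (1 / 2) (coeff (u s) - coeff (u τ)))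
      (𝓝[Set.Icc 0 S] τ) (𝓝 0)) :
    ContinuousOn (fun s => sqrtLap (coeff (u s))) (Set.Icc 0 S) := by
  intro τ hτ
  rw [ContinuousWithinAt, tendsto_iff_norm_sub_tendsto_zero]
  have h := (hcont τ hτ).const_mul (√κ)⁻¹
  rw [mul_zero] at h
  refine h.congr' ?_
  filter_upwards [self_mem_nhdsWithin] with s hs
  rw [((hmem s hs).sub (hmem τ hτ)).normDA_half hκ, (hmem s hs).sqrtLap_sub (hmem τ hτ),
    inv_mul_cancel_left₀ (Real.sqrt_pos.2 hκ).ne']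

/-- Retraction of the line onto `[0, S]`. -/
def clamp (S s : ℝ) : ℝ := max 0 (min S s)

lemma continuous_clamp (S : ℝ) : Continuous (clamp S) := by unfold clamp; fun_prop

lemma clamp_mem {S : ℝ} (hS : 0 ≤ S) (s : ℝ) : clamp S s ∈ Set.Icc 0 S :=
  ⟨le_max_left _ _, max_le hS (min_le_left _ _)⟩

lemma clamp_of_mem {S s : ℝ} (hs : s ∈ Set.Icc 0 S) : clamp S s = s := by
  simp [clamp, hs.1, hs.2]

/-- The `k`-th equation is multiplied by `√(lam k)`. Composition with `clamp` extends the solution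
continuously to all times, which makes the later continuity arguments global; the equations are
claimed on `[0, S]` only. -/
theorem IsSolution.exists_isModeSolution {ν Pr N ε S : ℝ} {F : ℝ → Coeffs} {ω ρ : ℝ → L2}
    (h : IsSolution ν Pr N ε S F ω ρ) (hν : 0 < ν) (hPr : 0 < Pr) (hS : 0 ≤ S)
    (hF : ∀ k, ∀ b, 0 ≤ b → IntervalIntegrable (fun τ => F τ k) volume 0 b) :
    ∃ Ω P : ℝ → SeqSpace, IsModeSolution ν (ν / Pr) N ε S F Ω P ∧
      ∀ τ ∈ Set.Icc 0 S, Ω τ = sqrtLap (coeff (ω τ)) ∧ P τ = sqrtLap (coeff (ρ τ)) := by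
  set Ω : ℝ → SeqSpace := fun s => sqrtLap (coeff (ω (clamp S s))) with hΩ
  set P : ℝ → SeqSpace := fun s => sqrtLap (coeff (ρ (clamp S s))) with hP
  have hΩv : ∀ s ∈ Set.Icc 0 S, Ω s = sqrtLap (coeff (ω s)) := fun s hs => by
    simp [hΩ, clamp_of_mem hs]
  have hPv : ∀ s ∈ Set.Icc 0 S, P s = sqrtLap (coeff (ρ s)) := fun s hs => by
    simp [hP, clamp_of_mem hs]
  have hΩc : Continuous Ω := (continuousOn_sqrtLap hν h.mem_vorticity
    h.cont_vorticity).comp_continuous (continuous_clamp S) (clamp_mem hS)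
  have hPc : Continuous P := (continuousOn_sqrtLap (div_pos hν hPr) h.mem_density
    h.cont_density).comp_continuous (continuous_clamp S) (clamp_mem hS)
  have h0 : (0 : ℝ) ∈ Set.Icc 0 S := ⟨le_rfl, hS⟩
  refine ⟨Ω, P, ⟨hΩc, hPc,
    fun τ => by simp [hΩ, (h.mem_vorticity _ (clamp_mem hS τ)).sqrtLap_apply],
    fun τ => by simp [hP, (h.mem_density _ (clamp_mem hS τ)).sqrtLap_apply], fun τ k => (h.mem_vorticity _ (clamp_mem hS τ)).sqrtLap_neg k,
    fun τ hτ k => ?_, fun τ hτ k => ?_⟩, fun τ hτ => ⟨hΩv τ hτ, hPv τ hτ⟩⟩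
  · rw [hΩv τ hτ, hΩv 0 h0, (h.mem_vorticity τ hτ).sqrtLap_apply,
      (h.mem_vorticity 0 h0).sqrtLap_apply, h.eq_vorticity τ hτ k]
    have hd := continuous_eval (Continuous.vorticityDrift hΩc hPc) k
    have hc := continuous_eval hΩc k
    have e1 : ∫ s in (0 : ℝ)..τ, (-(ν * lam k : ℝ) * coeff (ω s) k
        - UnitAddTorus.mFourierCoeff (jac (coeff (ω s)) (invLap (coeff (ω s)))) k
        + pderiv 0 (coeff (ρ s)) k + F s k) =
        ∫ s in (0 : ℝ)..τ, ((-(ν * lam k : ℝ) * (((√(lam k))⁻¹ : ℝ) * Ω s k)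
          + vorticityDrift (Ω s) (P s) k) + F s k) := by
      refine intervalIntegral.integral_congr fun s hs => ?_
      rw [Set.uIcc_of_le hτ.1] at hs
      have hs' : s ∈ Set.Icc 0 S := ⟨hs.1, hs.2.trans hτ.2⟩
      have hm := h.mem_vorticity s hs'
      have hmr := h.mem_density s hs'
      simp only [pderiv]
      rw [mFourierCoeff_jac hm hm, hm.eq_inv_mul k, hmr.eq_inv_mul k, hΩv s hs', hPv s hs']
      simp only [vorticityDrift, lp.coeFn_add, lp.coeFn_neg, Pi.add_apply, Pi.neg_apply,
        derivX_apply]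
      ring
    rw [e1, intervalIntegral.integral_add
      (Continuous.intervalIntegrable (by fun_prop) _ _) (hF k τ hτ.1),
      intervalIntegral.integral_const_mul]
    have e2 : ∫ s in (0 : ℝ)..τ, (-((ν * lam k : ℝ) : ℂ) * Ω s k
        + (√(lam k) : ℂ) * vorticityDrift (Ω s) (P s) k) = (√(lam k) : ℂ) *
        ∫ s in (0 : ℝ)..τ, (-(ν * lam k : ℝ) * (((√(lam k))⁻¹ : ℝ) * Ω s k)
          + vorticityDrift (Ω s) (P s) k) := by
      rw [← intervalIntegral.integral_const_mul]
      congr 1; ext s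
      have := sqrt_lam_mul_cancel k (Ω s k)
      push_cast at this ⊢
      linear_combination (ν : ℂ) * this
    rw [e2]
    ring
  · rw [hPv τ hτ, hPv 0 h0, (h.mem_density τ hτ).sqrtLap_apply,
      (h.mem_density 0 h0).sqrtLap_apply, h.eq_density τ hτ k]
    have e1 : ∫ s in (0 : ℝ)..τ, (-(ν / Pr * lam k : ℝ) * coeff (ρ s) k
        - UnitAddTorus.mFourierCoeff (jac (coeff (ρ s)) (invLap (coeff (ω s)))) k
        - (N : ℂ) ^ 2 * pderiv 0 (invLap (coeff (ω s))) k) =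
        ∫ s in (0 : ℝ)..τ, (-(ν / Pr * lam k : ℝ) * (((√(lam k))⁻¹ : ℝ) * P s k)
          + densityDrift N (Ω s) (P s) k) := by
      refine intervalIntegral.integral_congr fun s hs => ?_
      rw [Set.uIcc_of_le hτ.1] at hs
      have hs' : s ∈ Set.Icc 0 S := ⟨hs.1, hs.2.trans hτ.2⟩
      have hm := h.mem_vorticity s hs'
      have hmr := h.mem_density s hs'
      simp only [pderiv, invLap]
      rw [mFourierCoeff_jac hmr hm, hm.eq_inv_mul k, hmr.eq_inv_mul k, hΩv s hs', hPv s hs']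
      simp only [densityDrift, lp.coeFn_add, lp.coeFn_neg, lp.coeFn_smul, Pi.add_apply,
        Pi.neg_apply, Pi.smul_apply, derivXInvLap_apply, smul_eq_mul]
      push_cast
      ring
    rw [e1, intervalIntegral.integral_const_mul]
    have e2 : ∫ s in (0 : ℝ)..τ, (-((ν / Pr * lam k : ℝ) : ℂ) * P s k
        + (√(lam k) : ℂ) * densityDrift N (Ω s) (P s) k) = (√(lam k) : ℂ) *
        ∫ s in (0 : ℝ)..τ, (-(ν / Pr * lam k : ℝ) * (((√(lam k))⁻¹ : ℝ) * P s k)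
          + densityDrift N (Ω s) (P s) k) := by
      rw [← intervalIntegral.integral_const_mul]
      congr 1; ext s
      have := sqrt_lam_mul_cancel k (P s k)
      push_cast at this ⊢
      linear_combination (ν / Pr : ℂ) * this
    rw [e2]
    ring

/-! ### Integral inequalities -/

/-- Gronwall's inequality with a variable rate: `A` plus the integral, multiplied by `exp (-B)`, is
nonincreasing. -/
lemma le_mul_exp_integral {u b : ℝ → ℝ} {A S : ℝ} (hu : Continuous u) (hb : Continuous b)
    (hb0 : ∀ s, 0 ≤ b s) (h : ∀ τ ∈ Set.Icc 0 S, u τ ≤ A + ∫ s in (0 : ℝ)..τ, b s * u s)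
    {τ : ℝ} (hτ : τ ∈ Set.Icc 0 S) : u τ ≤ A * Real.exp (∫ s in (0 : ℝ)..τ, b s) := by
  set I : ℝ → ℝ := fun t => ∫ s in (0 : ℝ)..t, b s * u s
  set B : ℝ → ℝ := fun t => ∫ s in (0 : ℝ)..t, b s
  have hI : ∀ t, HasDerivAt I (b t * u t) t := fun t =>
    (hb.mul hu).integral_hasStrictDerivAt 0 t |>.hasDerivAt
  have hB : ∀ t, HasDerivAt B (b t) t := fun t =>
    hb.integral_hasStrictDerivAt 0 t |>.hasDerivAt
  have hd : ∀ t, HasDerivAt (fun t => (A + I t) * Real.exp (-B t))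
      ((b t * u t) * Real.exp (-B t) + (A + I t) * (Real.exp (-B t) * -b t)) t := fun t =>
    ((hI t).const_add A).mul (hB t).neg.exp
  have hanti : AntitoneOn (fun t => (A + I t) * Real.exp (-B t)) (Set.Icc 0 S) := by
    refine antitoneOn_of_hasDerivWithinAt_nonpos (convex_Icc 0 S)
      (fun t _ => (hd t).continuousAt.continuousWithinAt)
      (fun t _ => (hd t).hasDerivWithinAt) fun t ht => ?_
    have := h t (interior_subset ht)
    have h2 : 0 ≤ (A + I t - u t) * (b t * Real.exp (-B t)) :=
      mul_nonneg (sub_nonneg.2 this) (mul_nonneg (hb0 t) (Real.exp_nonneg _))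
    linarith
  have h1 := hanti ⟨le_rfl, hτ.1.trans hτ.2⟩ hτ hτ.1
  simp only [I, B, intervalIntegral.integral_same, neg_zero, Real.exp_zero, mul_one,
    add_zero] at h1
  calc u τ ≤ A + I τ := h τ hτ
    _ = (A + I τ) * Real.exp (-B τ) * Real.exp (B τ) := by
      rw [mul_assoc, ← Real.exp_add, neg_add_cancel, Real.exp_zero, mul_one]
    _ ≤ A * Real.exp (B τ) := by gcongr

lemma norm_sq_eq_add_integral {y h : ℝ → ℂ} {S : ℝ} (hh : Continuous h)
    (hy : ∀ s ∈ Set.Icc 0 S, y s = y 0 + ∫ r in (0 : ℝ)..s, h r) {τ : ℝ}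
    (hτ : τ ∈ Set.Icc 0 S) :
    ‖y τ‖ ^ 2 = ‖y 0‖ ^ 2 + ∫ s in (0 : ℝ)..τ, 2 * inner ℝ (y s) (h s) := by
  -- The equation for `y` holds on `[0, S]` only; the primitive `z` is differentiable everywhere and
  -- agrees with `y` there.
  set z : ℝ → ℂ := fun s => y 0 + ∫ r in (0 : ℝ)..s, h r with hz
  have hzd : ∀ s, HasDerivAt z (h s) s := fun s =>
    (hh.integral_hasStrictDerivAt 0 s).hasDerivAt.const_add _
  have hzc : Continuous z := continuous_iff_continuousAt.2 fun s => (hzd s).continuousAt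
  have h1 := intervalIntegral.integral_eq_sub_of_hasDerivAt (a := 0) (b := τ)
    (fun s _ => (hzd s).norm_sq)
    ((continuous_const.mul (hzc.inner hh)).intervalIntegrable _ _)
  have h2 : ∫ s in (0 : ℝ)..τ, 2 * inner ℝ (y s) (h s) =
      ∫ s in (0 : ℝ)..τ, 2 * inner ℝ (z s) (h s) := by
    refine intervalIntegral.integral_congr fun s hs => ?_
    rw [Set.uIcc_of_le hτ.1] at hs
    simp only [hz, ← hy s ⟨hs.1, hs.2.trans hτ.2⟩]
  rw [h2, h1, hy τ hτ]
  simp [hz]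

/-! ### Energy estimates -/

/-- The source carries `√l`, the dissipation `κ l ‖y‖²`. Completing the square leaves `‖n‖² / (4κ)`,
uniformly in the frequency. -/
lemma two_mul_inner_le {κ ε l : ℝ} (hκ : 0 < κ) (hε : 0 ≤ ε) (hl : 0 ≤ l) (y n : ℂ) :
    2 * inner ℝ y ((ε : ℂ) * (-((κ * l : ℝ) : ℂ) * y + (√l : ℂ) * n)) ≤
      ε / (2 * κ) * ‖n‖ ^ 2 := by
  have e : inner ℝ y ((ε : ℂ) * (-((κ * l : ℝ) : ℂ) * y + (√l : ℂ) * n)) =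
      ε * (-(κ * l) * ‖y‖ ^ 2 + √l * inner ℝ y n) := by
    have : (ε : ℂ) * (-((κ * l : ℝ) : ℂ) * y + (√l : ℂ) * n) =
        ε • ((-(κ * l)) • y + √l • n) := by
      simp only [Complex.real_smul]; push_cast; ring
    rw [this, inner_smul_right, inner_add_right, inner_smul_right, inner_smul_right,
      real_inner_self_eq_norm_sq]
  rw [e]
  have h1 := real_inner_le_norm y n
  have h2 : √l * inner ℝ y n ≤ √l * (‖y‖ * ‖n‖) := by gcongr
  have h3 : √l ^ 2 = l := Real.sq_sqrt hl
  have h4 : -(κ * l) * ‖y‖ ^ 2 + √l * (‖y‖ * ‖n‖) ≤ ‖n‖ ^ 2 / (4 * κ) := by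
    rw [le_div_iff₀ (by positivity)]
    have h5 := sq_nonneg (2 * κ * (√l * ‖y‖) - ‖n‖)
    have h6 : (2 * κ * (√l * ‖y‖) - ‖n‖) ^ 2 =
      4 * κ ^ 2 * (√l ^ 2) * ‖y‖ ^ 2 - 4 * κ * (√l * (‖y‖ * ‖n‖)) + ‖n‖ ^ 2 := by ring
    rw [h6, h3] at h5
    linarith
  calc 2 * (ε * (-(κ * l) * ‖y‖ ^ 2 + √l * inner ℝ y n))
      ≤ 2 * (ε * (‖n‖ ^ 2 / (4 * κ))) := by gcongr; linarith
    _ = ε / (2 * κ) * ‖n‖ ^ 2 := by field_simp; ring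

/-- Parabolic regularity: an `L²` source is controlled in `H¹`. -/
lemma sum_norm_sq_le_add_integral {κ ε S : ℝ} (hκ : 0 < κ) (hε : 0 ≤ ε) {Y : ℝ → Coeffs}
    {n : ℝ → SeqSpace} (hn : Continuous n) (hY : ∀ k, Continuous fun s => Y s k)
    (heq : ∀ s ∈ Set.Icc 0 S, ∀ k, Y s k = Y 0 k + ∫ r in (0 : ℝ)..s, (ε : ℂ) *
      (-(κ * lam k : ℝ) * Y r k + (√(lam k) : ℂ) * n r k)) {τ : ℝ} (hτ : τ ∈ Set.Icc 0 S)
    (K : Finset Freq) :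
    ∑ k ∈ K, ‖Y τ k‖ ^ 2 ≤
      ∑ k ∈ K, ‖Y 0 k‖ ^ 2 + ∫ s in (0 : ℝ)..τ, ε / (2 * κ) * ‖n s‖ ^ 2 := by
  have hnk : ∀ k, Continuous fun s => n s k := continuous_eval hn
  have hh : ∀ k, Continuous fun r => (ε : ℂ) *
      (-(κ * lam k : ℝ) * Y r k + (√(lam k) : ℂ) * n r k) := fun k => by
    have := hY k; have := hnk k; fun_prop
  have h1 : ∀ k ∈ K, ‖Y τ k‖ ^ 2 = ‖Y 0 k‖ ^ 2 + ∫ s in (0 : ℝ)..τ, 2 * inner ℝ (Y s k)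
      ((ε : ℂ) * (-(κ * lam k : ℝ) * Y s k + (√(lam k) : ℂ) * n s k)) := fun k _ =>
    norm_sq_eq_add_integral (y := fun s => Y s k) (hh k) (fun s hs => heq s hs k) hτ
  have hc : ∀ k, Continuous fun s => 2 * inner ℝ (Y s k)
      ((ε : ℂ) * (-(κ * lam k : ℝ) * Y s k + (√(lam k) : ℂ) * n s k)) := fun k =>
    continuous_const.mul ((hY k).inner (hh k))
  rw [Finset.sum_congr rfl h1, Finset.sum_add_distrib,
    ← intervalIntegral.integral_finsetSum fun k _ => (hc k).intervalIntegrable _ _]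
  gcongr
  refine intervalIntegral.integral_mono hτ.1
    ((continuous_finsetSum K fun k _ => hc k).intervalIntegrable _ _)
    ((continuous_const.mul (hn.norm.pow 2)).intervalIntegrable _ _) fun s => ?_
  calc _ ≤ ∑ k ∈ K, ε / (2 * κ) * ‖n s k‖ ^ 2 :=
        Finset.sum_le_sum fun k _ => two_mul_inner_le hκ hε (lam_nonneg k) _ _
    _ ≤ _ := by
      rw [← Finset.mul_sum]
      gcongr
      exact sum_norm_sq_le _ _

lemma norm_sq_le_add_integral {κ ε S : ℝ} (hκ : 0 < κ) (hε : 0 ≤ ε) {Y n : ℝ → SeqSpace}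
    (hn : Continuous n) (hY : Continuous Y)
    (heq : ∀ s ∈ Set.Icc 0 S, ∀ k, Y s k = Y 0 k + ∫ r in (0 : ℝ)..s, (ε : ℂ) *
      (-(κ * lam k : ℝ) * Y r k + (√(lam k) : ℂ) * n r k)) {τ : ℝ} (hτ : τ ∈ Set.Icc 0 S) :
    ‖Y τ‖ ^ 2 ≤ ‖Y 0‖ ^ 2 + ∫ s in (0 : ℝ)..τ, ε / (2 * κ) * ‖n s‖ ^ 2 := by
  refine le_of_tendsto (hasSum_norm_sq (Y τ)) (Eventually.of_forall fun K => ?_)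
  refine (sum_norm_sq_le_add_integral (Y := fun s => ⇑(Y s)) hκ hε hn (continuous_eval hY) heq
    hτ K).trans ?_
  gcongr
  exact sum_norm_sq_le _ _

lemma lam_mul_sq {Y : SeqSpace} (h0 : Y 0 = 0) (k : Freq) :
    lam k * ‖invSqrtLap Y k‖ ^ 2 = ‖Y k‖ ^ 2 := by
  rcases eq_or_ne k 0 with rfl | hk
  · simp [h0]
  · rw [invSqrtLap_apply, norm_mul, Complex.norm_real, mul_pow, norm_inv, Real.norm_eq_abs,
      inv_pow, sq_abs, Real.sq_sqrt (lam_nonneg k), mul_inv_cancel_left₀ (lam_pos hk).ne']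

lemma hasSum_energy (κ ε : ℝ) {Y n : SeqSpace} (h0 : Y 0 = 0) :
    HasSum (fun k => 2 * inner ℝ (invSqrtLap Y k) ((ε : ℂ) *
      (-(κ * lam k : ℝ) * invSqrtLap Y k + n k)))
      (2 * ε * (-(κ * ‖Y‖ ^ 2) + (inner ℂ (invSqrtLap Y) n).re)) := by
  have h1 := (hasSum_norm_sq Y).mul_left κ
  have h2 := Complex.hasSum_re (lp.hasSum_inner (invSqrtLap Y) n)
  refine ((h1.neg.add h2).mul_left (2 * ε)).congr_fun fun k => ?_
  have e1 : ((ε : ℂ) * (-(κ * lam k : ℝ) * invSqrtLap Y k + n k)) =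
      ε • ((-(κ * lam k)) • invSqrtLap Y k + n k) := by
    simp only [Complex.real_smul]; push_cast; ring
  have e2 := lam_mul_sq h0 k
  rw [e1, inner_smul_right, inner_add_right, inner_smul_right, real_inner_self_eq_norm_sq]
  simp only [Complex.inner, RCLike.inner_apply]
  rw [← e2, mul_comm (n k)]
  simp
  ring

/-- The energy identity in `L²`. -/
lemma norm_invSqrtLap_sq_eq {κ ε S : ℝ} (hκ : 0 ≤ κ) (hε : 0 ≤ ε) {Y n : ℝ → SeqSpace}
    (hn : Continuous n) (hY : Continuous Y) (h0 : ∀ s, Y s 0 = 0)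
    (heq : ∀ s ∈ Set.Icc 0 S, ∀ k, Y s k = Y 0 k + ∫ r in (0 : ℝ)..s, (ε : ℂ) *
      (-(κ * lam k : ℝ) * Y r k + (√(lam k) : ℂ) * n r k)) {τ : ℝ} (hτ : τ ∈ Set.Icc 0 S) :
    ‖invSqrtLap (Y τ)‖ ^ 2 = ‖invSqrtLap (Y 0)‖ ^ 2 + ∫ s in (0 : ℝ)..τ,
      2 * ε * (-(κ * ‖Y s‖ ^ 2) + (inner ℂ (invSqrtLap (Y s)) (n s)).re) := by
  have hYi : Continuous fun s => invSqrtLap (Y s) := invSqrtLap.continuous.comp hY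
  have hYk := continuous_eval hYi
  have hnk := continuous_eval hn
  have hh : ∀ k, Continuous fun s => (ε : ℂ) *
      (-(κ * lam k : ℝ) * invSqrtLap (Y s) k + n s k) := fun k => by
    have := hYk k; have := hnk k; fun_prop
  have hmode : ∀ k, ‖invSqrtLap (Y τ) k‖ ^ 2 = ‖invSqrtLap (Y 0) k‖ ^ 2 +
      ∫ s in (0 : ℝ)..τ, 2 * inner ℝ (invSqrtLap (Y s) k) ((ε : ℂ) *
        (-(κ * lam k : ℝ) * invSqrtLap (Y s) k + n s k)) := by
    intro k
    rcases eq_or_ne k 0 with rfl | hk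
    · simp
    refine norm_sq_eq_add_integral (y := fun s => invSqrtLap (Y s) k) (hh k) (fun s hs => ?_) hτ
    have hne : (√(lam k) : ℂ) ≠ 0 := by
      exact_mod_cast (Real.sqrt_pos.2 (lam_pos hk)).ne'
    simp only [invSqrtLap_apply]
    rw [heq s hs k, mul_add, ← intervalIntegral.integral_const_mul]
    congr 2
    ext r
    push_cast
    field_simp
  have hsum : HasSum (fun k => ∫ s in (0 : ℝ)..τ, 2 * inner ℝ (invSqrtLap (Y s) k) ((ε : ℂ) *
      (-(κ * lam k : ℝ) * invSqrtLap (Y s) k + n s k))) (∫ s in (0 : ℝ)..τ,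
      2 * ε * (-(κ * ‖Y s‖ ^ 2) + (inner ℂ (invSqrtLap (Y s)) (n s)).re)) := by
    -- A majorant for exchanging sum and time integral. It is summable because the diffusion term `λ
    -- ‖λ^(-1/2) Y‖²` is just `‖Y‖²`.
    have hb : ∀ s, HasSum (fun k => 2 * ε * (κ * ‖Y s k‖ ^ 2 + (‖invSqrtLap (Y s) k‖ ^ 2 +
        ‖n s k‖ ^ 2))) (2 * ε * (κ * ‖Y s‖ ^ 2 + (‖invSqrtLap (Y s)‖ ^ 2 + ‖n s‖ ^ 2))) :=
      fun s => (((hasSum_norm_sq _).mul_left κ).add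
        ((hasSum_norm_sq _).add (hasSum_norm_sq _))).mul_left _
    refine intervalIntegral.hasSum_integral_of_dominated_convergence
      (fun k s => 2 * ε * (κ * ‖Y s k‖ ^ 2 + (‖invSqrtLap (Y s) k‖ ^ 2 + ‖n s k‖ ^ 2)))
      (fun k => (continuous_const.mul ((hYk k).inner (hh k))).aestronglyMeasurable)
      (fun k => Eventually.of_forall fun s _ => ?_)
      (Eventually.of_forall fun s _ => (hb s).summable) ?_
      (Eventually.of_forall fun s _ => hasSum_energy κ ε (h0 s))
    · rw [norm_mul, Real.norm_ofNat, mul_assoc]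
      gcongr
      refine (norm_inner_le_norm _ _).trans ?_
      rw [norm_mul, Complex.norm_real, Real.norm_of_nonneg hε, mul_left_comm]
      gcongr
      have h1 : ‖-((κ * lam k : ℝ) : ℂ) * invSqrtLap (Y s) k + n s k‖ ≤
          κ * lam k * ‖invSqrtLap (Y s) k‖ + ‖n s k‖ := by
        refine (norm_add_le _ _).trans ?_
        rw [norm_mul, norm_neg, Complex.norm_real,
          Real.norm_of_nonneg (mul_nonneg hκ (lam_nonneg k))]
      have h2 : lam k * ‖invSqrtLap (Y s) k‖ ^ 2 = ‖Y s k‖ ^ 2 := lam_mul_sq (h0 s) k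
      have h3 := mul_le_mul_of_nonneg_left h1 (norm_nonneg (invSqrtLap (Y s) k))
      refine h3.trans ?_
      rw [← h2]
      nlinarith [sq_nonneg (‖invSqrtLap (Y s) k‖ - ‖n s k‖), sq_nonneg ‖invSqrtLap (Y s) k‖,
        sq_nonneg ‖n s k‖]
    · simp only [(hb _).tsum_eq]
      exact Continuous.intervalIntegrable (by fun_prop) _ _
  refine (hasSum_norm_sq _).unique ?_
  simp only [hmode]
  exact (hasSum_norm_sq _).add hsum

/-! ### Finite Euclidean norms -/

/-- The Euclidean norm of the coefficients with frequencies in `K`. -/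
def finNorm (K : Finset Freq) (c : Coeffs) : ℝ := √(∑ k ∈ K, ‖c k‖ ^ 2)

lemma finNorm_eq (K : Finset Freq) (c : Coeffs) :
    finNorm K c = ‖(WithLp.toLp 2 fun k : K => c k : EuclideanSpace ℂ K)‖ := by
  rw [EuclideanSpace.norm_eq, finNorm, ← Finset.sum_coe_sort]

lemma finNorm_add_le (K : Finset Freq) (c d : Coeffs) :
    finNorm K (c + d) ≤ finNorm K c + finNorm K d := by
  have e : (WithLp.toLp 2 fun k : K => (c + d) k : EuclideanSpace ℂ K) =
      (WithLp.toLp 2 fun k : K => c k) + (WithLp.toLp 2 fun k : K => d k) := by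
    ext k; simp
  rw [finNorm_eq, finNorm_eq, finNorm_eq, e]
  exact norm_add_le _ _

lemma finNorm_nonneg (K : Finset Freq) (c : Coeffs) : 0 ≤ finNorm K c := Real.sqrt_nonneg _

lemma sq_finNorm (K : Finset Freq) (c : Coeffs) : finNorm K c ^ 2 = ∑ k ∈ K, ‖c k‖ ^ 2 :=
  Real.sq_sqrt (Finset.sum_nonneg fun _ _ => sq_nonneg _)

lemma finNorm_le_mul {K : Finset Freq} {c d : Coeffs} {B : ℝ} (hB : 0 ≤ B)
    (h : ∀ k, ‖c k‖ ≤ B * ‖d k‖) : finNorm K c ≤ B * finNorm K d := by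
  refine Real.sqrt_le_iff.2 ⟨mul_nonneg hB (finNorm_nonneg K d), ?_⟩
  rw [mul_pow, sq_finNorm, Finset.mul_sum]
  gcongr with k
  rw [← mul_pow]
  gcongr
  exact h k

/-- Minkowski's inequality for integrals. -/
lemma finNorm_integral_le {K : Finset Freq} {h : ℝ → Coeffs}
    (hc : ∀ k, Continuous fun t => h t k) {a b : ℝ} (hab : a ≤ b) {g : ℝ → ℝ}
    (hb : ∀ t ∈ Set.Ioc a b, finNorm K (h t) ≤ g t) (hg : IntervalIntegrable g volume a b) :
    finNorm K (fun k => ∫ t in a..b, h t k) ≤ ∫ t in a..b, g t := by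
  have e : (WithLp.toLp 2 fun k : K => ∫ t in a..b, h t k : EuclideanSpace ℂ K) =
      ∫ t in a..b, (WithLp.toLp 2 fun k : K => h t k : EuclideanSpace ℂ K) := by
    ext k
    rw [intervalIntegral.integral_of_le hab, eval_integral_piLp]
    · simp [intervalIntegral.integral_of_le hab]
    · intro i
      exact ((hc i).intervalIntegrable a b).1
  rw [finNorm_eq, e]
  refine intervalIntegral.norm_integral_le_of_norm_le hab
    (Eventually.of_forall fun t ht => ?_) hg
  rw [← finNorm_eq]
  exact hb t ht

/-! ### Smoothing of the heat semigroup -/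

lemma rpow_le_exp {x p : ℝ} (hx : 0 < x) (hp0 : 0 ≤ p) (hp : p ≤ 1) : x ^ p ≤ Real.exp x := by
  rw [Real.rpow_def_of_pos hx]
  gcongr
  have := Real.log_le_sub_one_of_pos hx
  nlinarith

/-- With `1 + p ≤ 2`, `(1 + p) log (x/2) ≤ (1 + p) (x/2 - 1) ≤ x`; halving `x` costs `2^(1+p) ≤ 4`.
-/
lemma rpow_one_add_le_exp {x p : ℝ} (hx : 0 < x) (hp0 : 0 ≤ p) (hp : p ≤ 1) :
    x ^ (1 + p) ≤ 4 * Real.exp x := by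
  have h1 : x ^ (1 + p) = 2 ^ (1 + p) * (x / 2) ^ (1 + p) := by
    rw [← Real.mul_rpow (by norm_num) (by positivity)]; congr 1; ring
  have h2 : (2 : ℝ) ^ (1 + p) ≤ 4 := by
    calc (2 : ℝ) ^ (1 + p) ≤ 2 ^ (2 : ℝ) := by gcongr <;> linarith
      _ = 4 := by norm_num
  have h3 : (x / 2) ^ (1 + p) ≤ Real.exp x := by
    rw [Real.rpow_def_of_pos (by positivity)]
    gcongr
    have := Real.log_le_sub_one_of_pos (half_pos hx)
    nlinarith
  rw [h1]; gcongr

/-- Heat smoothing: `b` is diffusivity times elapsed time, and passing from the weight `l^(1/2-p)`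
to `l^(1/2)` costs `b^(-p)`. -/
lemma sqrt_mul_exp_le {l b p : ℝ} (hl : 0 ≤ l) (hb : 0 < b) (hp0 : 0 ≤ p) (hp : p ≤ 1) :
    √l * Real.exp (-(b * l)) ≤ b ^ (-p) * l ^ (1 / 2 - p) := by
  rcases hl.eq_or_lt with rfl | hl
  · simp; positivity
  have h1 := rpow_le_exp (mul_pos hb hl) hp0 hp
  rw [Real.mul_rpow hb.le hl.le] at h1
  have h2 : √l = l ^ (1 / 2 - p) * l ^ p := by
    rw [Real.sqrt_eq_rpow, ← Real.rpow_add hl]; congr 1; ring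
  rw [h2, Real.rpow_neg hb.le, Real.exp_neg, mul_comm (_)⁻¹, mul_assoc, ← div_eq_mul_inv,
    ← div_eq_mul_inv]
  rw [div_eq_mul_inv (l ^ (1 / 2 - p))]
  gcongr
  rw [div_le_iff₀ (Real.exp_pos _), inv_mul_eq_div, le_div_iff₀ (by positivity), mul_comm]
  exact h1

lemma sqrt_mul_mul_exp_le {l b p : ℝ} (hl : 0 ≤ l) (hb : 0 < b) (hp0 : 0 ≤ p) (hp : p ≤ 1) :
    √l * (b * l * Real.exp (-(b * l))) ≤ 4 * b ^ (-p) * l ^ (1 / 2 - p) := by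
  rcases hl.eq_or_lt with rfl | hl
  · simp; positivity
  have h1 := rpow_one_add_le_exp (mul_pos hb hl) hp0 hp
  rw [Real.rpow_add (mul_pos hb hl), Real.rpow_one, Real.mul_rpow hb.le hl.le] at h1
  have h2 : √l = l ^ (1 / 2 - p) * l ^ p := by
    rw [Real.sqrt_eq_rpow, ← Real.rpow_add hl]; congr 1; ring
  have hbp : 0 < b ^ p := by positivity
  have hE := Real.exp_pos (b * l)
  rw [h2, Real.rpow_neg hb.le, Real.exp_neg]
  have e1 : l ^ (1 / 2 - p) * l ^ p * (b * l * (Real.exp (b * l))⁻¹) =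
      l ^ (1 / 2 - p) * (b ^ p)⁻¹ * (b * l * (b ^ p * l ^ p)) * (Real.exp (b * l))⁻¹ := by
    field_simp
  have e2 : 4 * (b ^ p)⁻¹ * l ^ (1 / 2 - p) =
      l ^ (1 / 2 - p) * (b ^ p)⁻¹ * (4 * Real.exp (b * l)) * (Real.exp (b * l))⁻¹ := by
    field_simp
  rw [e1, e2]
  gcongr

/-! ### The forced heat equation -/

/-- `e ^ (-a τ) ∫_0^τ e ^ (a s) g(s) ds`. -/
def duhamel (a : ℝ) (g : ℝ → ℂ) (τ : ℝ) : ℂ :=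
  (Real.exp (-(a * τ)) : ℂ) * ∫ s in (0 : ℝ)..τ, (Real.exp (a * s) : ℂ) * g s

lemma hasDerivAt_duhamel (a : ℝ) {g : ℝ → ℂ} (hg : Continuous g) (τ : ℝ) :
    HasDerivAt (duhamel a g) (g τ - a * duhamel a g τ) τ := by
  have h1 : HasDerivAt (fun τ : ℝ => (Real.exp (-(a * τ)) : ℂ))
      ((Real.exp (-(a * τ)) * -(a * 1) : ℝ) : ℂ) τ :=
    ((((hasDerivAt_id τ).const_mul a).neg).exp).ofReal_comp
  have hc : Continuous fun s : ℝ => (Real.exp (a * s) : ℂ) * g s := by fun_prop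
  have h2 := (hc.integral_hasStrictDerivAt 0 τ).hasDerivAt
  convert! h1.mul h2 using 1
  have h3 : (Real.exp (-(a * τ)) : ℂ) * (Real.exp (a * τ) : ℂ) = 1 := by
    rw [← Complex.ofReal_mul, ← Real.exp_add]; simp
  unfold duhamel
  push_cast at h3 ⊢
  linear_combination (-g τ) * h3

lemma duhamel_zero (a : ℝ) (g : ℝ → ℂ) : duhamel a g 0 = 0 := by simp [duhamel]

lemma continuous_duhamel (a : ℝ) {g : ℝ → ℂ} (hg : Continuous g) : Continuous (duhamel a g) :=
  continuous_iff_continuousAt.2 fun τ => (hasDerivAt_duhamel a hg τ).continuousAt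

/-- The solution of `v' + a v = ε g'`, `v(0) = 0`. -/
def heatResponse (ε a : ℝ) (g : ℝ → ℂ) (τ : ℝ) : ℂ := ε * (g τ - a * duhamel a g τ)

lemma continuous_heatResponse (ε a : ℝ) {g : ℝ → ℂ} (hg : Continuous g) :
    Continuous (heatResponse ε a g) := by
  have := continuous_duhamel a hg
  unfold heatResponse; fun_prop

/-- This is the integrated meaning of `v' + a v = ε g'` when `g` is merely continuous. -/
lemma heatResponse_eq_integral (ε a : ℝ) {g : ℝ → ℂ} (hg : Continuous g) (τ : ℝ) :
    heatResponse ε a g τ = -a * (∫ s in (0 : ℝ)..τ, heatResponse ε a g s) + ε * g τ := by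
  have h := intervalIntegral.integral_eq_sub_of_hasDerivAt (a := 0) (b := τ)
    (fun s _ => (hasDerivAt_duhamel a hg s).const_mul (ε : ℂ))
    ((continuous_heatResponse ε a hg).intervalIntegrable _ _)
  have h' : ∫ s in (0 : ℝ)..τ, heatResponse ε a g s = ε * duhamel a g τ := by
    unfold heatResponse; rw [h, duhamel_zero]; simp
  rw [h']
  unfold heatResponse
  ring

lemma duhamel_eq (a : ℝ) (g : ℝ → ℂ) (τ : ℝ) :
    duhamel a g τ = ∫ L in (0 : ℝ)..τ, (Real.exp (-(a * L)) : ℂ) * g (τ - L) := by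
  have h := intervalIntegral.integral_comp_sub_left (a := 0) (b := τ)
    (fun s => (Real.exp (-(a * (τ - s))) : ℂ) * g s) τ
  simp only [sub_sub_cancel, sub_self, sub_zero] at h
  rw [h]
  unfold duhamel
  rw [← intervalIntegral.integral_const_mul]
  congr 1; ext s
  rw [← mul_assoc, ← Complex.ofReal_mul, ← Real.exp_add]
  congr 4; ring

/-- The kernel `a e^(-aL)` has mass `1 - e^(-aτ)` on `[0, τ]`, so `g τ` can be subtracted under the
integral. Only increments of `g` remain there, and they vanish at `L = 0`, where smoothing is
singular. -/
lemma heatResponse_eq (ε a : ℝ) {g : ℝ → ℂ} (hg : Continuous g) (τ : ℝ) :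
    heatResponse ε a g τ = ε * ((Real.exp (-(a * τ)) : ℂ) * g τ) + ε *
      ∫ L in (0 : ℝ)..τ, ((a * Real.exp (-(a * L)) : ℝ) : ℂ) * (g τ - g (τ - L)) := by
  have h1 : ∫ L in (0 : ℝ)..τ, (a * Real.exp (-(a * L)) : ℝ) = 1 - Real.exp (-(a * τ)) := by
    have hd : ∀ L ∈ Set.uIcc 0 τ, HasDerivAt (fun L => -Real.exp (-(a * L)))
        (a * Real.exp (-(a * L))) L := fun L _ => by
      convert! (((hasDerivAt_id L).const_mul a).neg.exp).neg using 1
      simp; ring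
    rw [intervalIntegral.integral_eq_sub_of_hasDerivAt hd
      (Continuous.intervalIntegrable (by fun_prop) _ _)]
    simp; ring
  have h2 : ∫ L in (0 : ℝ)..τ, ((a * Real.exp (-(a * L)) : ℝ) : ℂ) * (g τ - g (τ - L)) =
      (∫ L in (0 : ℝ)..τ, ((a * Real.exp (-(a * L)) : ℝ) : ℂ) * g τ) -
      ∫ L in (0 : ℝ)..τ, (a : ℂ) * ((Real.exp (-(a * L)) : ℂ) * g (τ - L)) := by
    rw [← intervalIntegral.integral_sub
      (Continuous.intervalIntegrable (by fun_prop) _ _)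
      (Continuous.intervalIntegrable (by fun_prop) _ _)]
    congr 1; ext L; push_cast; ring
  rw [h2, intervalIntegral.integral_mul_const, intervalIntegral.integral_ofReal, h1,
    intervalIntegral.integral_const_mul, ← duhamel_eq]
  unfold heatResponse
  push_cast
  ring

/-- Smoothing bounds the kernel by a multiple of `L^(-1-p)`, and the increment of `G` supplies `L (δ
+ C L^(-r))`. The product is integrable since `p + r < 1`; the integration yields the factor `1 / (1
- p - r)`. -/
lemma finNorm_heatResponse_le {ν ε p r δ C τ : ℝ} (hν : 0 < ν) (hε : 0 < ε) (hp0 : 0 ≤ p)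
    (hr : 0 < r) (hpr : p + r < 1) (hδ : 0 ≤ δ) (hτ : 0 < τ) {G : ℝ → Coeffs}
    (hG : ∀ k, Continuous fun s => G s k) (hG0 : G 0 = 0) {K : Finset Freq}
    (hinc : ∀ s t, 0 ≤ s → s < t →
      finNorm K (fun k => ((lam k ^ (1 / 2 - p) : ℝ) : ℂ) * (G t k - G s k)) ≤
        (t - s) * (δ + C * (t - s) ^ (-r))) :
    finNorm K (fun k => (√(lam k) : ℂ) * heatResponse ε (ε * ν * lam k) (fun s => G s k) τ) ≤
      ε * (ε * ν) ^ (-p) * ((1 + 4 / (1 - p - r)) *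
        (δ * τ ^ (1 - p) + C * τ ^ (1 - p - r))) := by
  have hεν : 0 < ε * ν := mul_pos hε hν
  have e : (fun k => (√(lam k) : ℂ) * heatResponse ε (ε * ν * lam k) (fun s => G s k) τ) =
      (fun k => (ε : ℂ) * ((√(lam k) * Real.exp (-((ε * ν * τ) * lam k)) : ℝ) : ℂ) *
        (G τ k - G 0 k)) +
      fun k => ∫ L in (0 : ℝ)..τ, (ε : ℂ) * (√(lam k) *
        (ε * ν * lam k * Real.exp (-(ε * ν * lam k * L)) : ℝ) : ℂ) * (G τ k - G (τ - L) k) := by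
    ext k
    have e1 : ∀ L, (ε : ℂ) * (√(lam k) * (ε * ν * lam k * Real.exp (-(ε * ν * lam k * L)) : ℝ)
        : ℂ) * (G τ k - G (τ - L) k) = (ε : ℂ) * √(lam k) *
        (((ε * ν * lam k * Real.exp (-(ε * ν * lam k * L)) : ℝ) : ℂ) *
          (G τ k - G (τ - L) k)) := fun L => by ring
    simp only [Pi.add_apply, e1]
    rw [heatResponse_eq _ _ (hG k), intervalIntegral.integral_const_mul, hG0,
      show ε * ν * lam k * τ = ε * ν * τ * lam k by ring]
    simp only [Pi.zero_apply]
    push_cast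
    ring
  have hA : finNorm K (fun k => (ε : ℂ) * ((√(lam k) *
      Real.exp (-((ε * ν * τ) * lam k)) : ℝ) : ℂ) * (G τ k - G 0 k)) ≤
      ε * (ε * ν * τ) ^ (-p) * (τ * (δ + C * τ ^ (-r))) := by
    have h1 := hinc 0 τ le_rfl hτ
    rw [sub_zero] at h1
    refine (finNorm_le_mul (B := ε * (ε * ν * τ) ^ (-p)) (by positivity) fun k => ?_).trans
      (mul_le_mul_of_nonneg_left h1 (by positivity))
    have hl := lam_nonneg k
    rw [norm_mul, norm_mul, norm_mul, Complex.norm_real, Complex.norm_real, Complex.norm_real,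
      Real.norm_of_nonneg hε.le, Real.norm_of_nonneg (by positivity),
      Real.norm_of_nonneg (by positivity)]
    have h2 := sqrt_mul_exp_le hl (show 0 < ε * ν * τ by positivity) hp0 (by linarith)
    calc _ ≤ ε * ((ε * ν * τ) ^ (-p) * lam k ^ (1 / 2 - p)) * ‖G τ k - G 0 k‖ := by gcongr
      _ = _ := by ring
  have hB : finNorm K (fun k => ∫ L in (0 : ℝ)..τ, (ε : ℂ) * (√(lam k) *
        (ε * ν * lam k * Real.exp (-(ε * ν * lam k * L)) : ℝ) : ℂ) * (G τ k - G (τ - L) k)) ≤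
      ∫ L in (0 : ℝ)..τ, 4 * ε * (ε * ν) ^ (-p) * (δ * L ^ (-p) + C * L ^ (-(p + r))) := by
    refine finNorm_integral_le (fun k => ?_) hτ.le (fun L hL => ?_) ?_
    · have := hG k
      fun_prop
    · have hL0 := hL.1
      have h1 := hinc (τ - L) τ (sub_nonneg.2 hL.2) (by linarith)
      rw [sub_sub_cancel] at h1
      refine (finNorm_le_mul (B := ε * L⁻¹ * (4 * (ε * ν * L) ^ (-p))) (by positivity)
        fun k => ?_).trans ((mul_le_mul_of_nonneg_left h1 (by positivity)).trans_eq ?_)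
      · have hl := lam_nonneg k
        have h2 := sqrt_mul_mul_exp_le hl (show 0 < ε * ν * L by positivity) hp0
          (by linarith)
        rw [norm_mul, norm_mul, norm_mul, norm_mul, Complex.norm_real, Complex.norm_real,
          Complex.norm_real, Complex.norm_real, Real.norm_of_nonneg hε.le,
          Real.norm_of_nonneg (by positivity), Real.norm_of_nonneg (by positivity),
          Real.norm_of_nonneg (by positivity)]
        have h3 : √(lam k) * (ε * ν * lam k * Real.exp (-(ε * ν * lam k * L))) =
            L⁻¹ * (√(lam k) * (ε * ν * L * lam k * Real.exp (-(ε * ν * L * lam k)))) := by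
          rw [show ε * ν * lam k * L = ε * ν * L * lam k by ring]
          field_simp
        rw [h3]
        calc _ ≤ ε * (L⁻¹ * (4 * (ε * ν * L) ^ (-p) * lam k ^ (1 / 2 - p))) *
              ‖G τ k - G (τ - L) k‖ := by gcongr
          _ = _ := by ring
      · rw [Real.mul_rpow hεν.le hL0.le, neg_add, Real.rpow_add hL0]
        field_simp
    · refine IntervalIntegrable.const_mul (((intervalIntegral.intervalIntegrable_rpow'
        (by linarith)).const_mul _).add ((intervalIntegral.intervalIntegrable_rpow'
        (by linarith)).const_mul _)) _
  have hI : ∫ L in (0 : ℝ)..τ, 4 * ε * (ε * ν) ^ (-p) * (δ * L ^ (-p) + C * L ^ (-(p + r))) =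
      4 * ε * (ε * ν) ^ (-p) *
        (δ * (τ ^ (1 - p) / (1 - p)) + C * (τ ^ (1 - p - r) / (1 - p - r))) := by
    rw [intervalIntegral.integral_const_mul, intervalIntegral.integral_add
      ((intervalIntegral.intervalIntegrable_rpow' (by linarith)).const_mul _)
      ((intervalIntegral.intervalIntegrable_rpow' (by linarith)).const_mul _),
      intervalIntegral.integral_const_mul, intervalIntegral.integral_const_mul,
      integral_rpow (Or.inl (by linarith)), integral_rpow (Or.inl (by linarith)),
      Real.zero_rpow (by linarith), Real.zero_rpow (by linarith),
      show -p + 1 = 1 - p by ring, show -(p + r) + 1 = 1 - p - r by ring, sub_zero, sub_zero]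
  rw [e]
  refine (finNorm_add_le K _ _).trans ((add_le_add hA (hB.trans_eq hI)).trans ?_)
  have h1 : (ε * ν * τ) ^ (-p) * (τ * (δ + C * τ ^ (-r))) =
      (ε * ν) ^ (-p) * (δ * τ ^ (1 - p) + C * τ ^ (1 - p - r)) := by
    rw [Real.mul_rpow hεν.le hτ.le, show 1 - p = -p + 1 by ring,
      show -p + 1 - r = -p + 1 + -r by ring, Real.rpow_add hτ, Real.rpow_add hτ,
      Real.rpow_add hτ, Real.rpow_one]
    ring
  have h2 : τ ^ (1 - p) / (1 - p) ≤ τ ^ (1 - p) / (1 - p - r) := by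
    have : 0 < 1 - p - r := by linarith
    exact div_le_div_of_nonneg_left (by positivity) this (by linarith)
  calc _ = ε * (ε * ν) ^ (-p) * ((δ * τ ^ (1 - p) + C * τ ^ (1 - p - r)) + 4 *
        (δ * (τ ^ (1 - p) / (1 - p)) + C * (τ ^ (1 - p - r) / (1 - p - r)))) := by
        rw [mul_assoc ε, h1]; ring
    _ ≤ ε * (ε * ν) ^ (-p) * ((δ * τ ^ (1 - p) + C * τ ^ (1 - p - r)) + 4 *
        (δ * (τ ^ (1 - p) / (1 - p - r)) + C * (τ ^ (1 - p - r) / (1 - p - r)))) := by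
        gcongr
    _ = _ := by ring

/-- The response to a force with vanishing time average is small in `H¹`, uniformly on time
intervals of length `T / ε`. -/
lemma eventually_finNorm_heatResponse_le {ν p r T : ℝ} (hν : 0 < ν) (hp0 : 0 ≤ p) (hr : 0 < r)
    (hpr : p + r < 1) (hT : 0 < T) {G : ℝ → Coeffs}
    (hG : ∀ k, Continuous fun s => G s k) (hG0 : G 0 = 0)
    (hinc : ∀ δ, 0 < δ → ∃ C, 0 ≤ C ∧ ∀ K : Finset Freq, ∀ s t, 0 ≤ s → s < t →
      finNorm K (fun k => ((lam k ^ (1 / 2 - p) : ℝ) : ℂ) * (G t k - G s k)) ≤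
        (t - s) * (δ + C * (t - s) ^ (-r))) {η : ℝ} (hη : 0 < η) :
    ∀ᶠ ε in 𝓝[>] (0 : ℝ), ∀ τ, 0 ≤ τ → τ ≤ T / ε → ∀ K : Finset Freq,
      finNorm K (fun k => (√(lam k) : ℂ) *
        heatResponse ε (ε * ν * lam k) (fun s => G s k) τ) ≤ η := by
  set c : ℝ := ν ^ (-p) * (1 + 4 / (1 - p - r)) with hc
  have hpr' : 0 < 1 - p - r := by linarith
  have hc0 : 0 < c := by positivity
  -- This `δ` makes the first contribution `η / 2`, since `ε τ ≤ T`. The second one keeps a spare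
  -- factor `ε ^ r` and tends to zero whatever `C` is.
  obtain ⟨C, hC, hCi⟩ := hinc (η / 2 / (c * T ^ (1 - p))) (by positivity)
  have hlim : Tendsto (fun ε : ℝ => c * (C * T ^ (1 - p - r)) * ε ^ r) (𝓝[>] 0) (𝓝 0) := by
    have : Tendsto (fun ε : ℝ => ε ^ r) (𝓝[>] 0) (𝓝 0) := by
      have h := (Real.continuousAt_rpow_const 0 r (Or.inr hr.le)).tendsto
      rw [Real.zero_rpow hr.ne'] at h
      exact h.mono_left nhdsWithin_le_nhds
    simpa using this.const_mul (c * (C * T ^ (1 - p - r)))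
  filter_upwards [hlim.eventually_le_const (half_pos hη), self_mem_nhdsWithin] with ε hε1 hε τ
    hτ0 hτ K
  have hε : 0 < ε := hε
  rcases hτ0.eq_or_lt with rfl | hτ0
  · have : (fun k => (√(lam k) : ℂ) *
        heatResponse ε (ε * ν * lam k) (fun s => G s k) 0) = 0 := by
      ext k; simp [heatResponse, duhamel_zero, hG0]
    rw [this]
    simpa [finNorm] using hη.le
  refine (finNorm_heatResponse_le hν hε hp0 hr hpr (by positivity) hτ0 hG hG0
    (hCi K)).trans ?_
  have hετ : ε * τ ≤ T := by rwa [le_div_iff₀ hε, mul_comm] at hτ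
  have hετ0 : 0 < ε * τ := mul_pos hε hτ0
  have h1 : ε * (ε * ν) ^ (-p) = ν ^ (-p) * ε ^ (1 - p) := by
    rw [Real.mul_rpow hε.le hν.le, sub_eq_add_neg, Real.rpow_add hε, Real.rpow_one]; ring
  have h2 : ε ^ (1 - p) * τ ^ (1 - p) ≤ T ^ (1 - p) := by
    rw [← Real.mul_rpow hε.le hτ0.le]
    exact Real.rpow_le_rpow hετ0.le hετ (by linarith)
  have h3 : ε ^ (1 - p) * τ ^ (1 - p - r) ≤ T ^ (1 - p - r) * ε ^ r := by
    rw [show ε ^ (1 - p) = ε ^ (1 - p - r) * ε ^ r by rw [← Real.rpow_add hε]; congr 1; ring,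
      mul_right_comm, ← Real.mul_rpow hε.le hτ0.le]
    gcongr
  set δ := η / 2 / (c * T ^ (1 - p)) with hδ
  have hδ0 : 0 < δ := by positivity
  calc _ = c * (δ * (ε ^ (1 - p) * τ ^ (1 - p)) + C * (ε ^ (1 - p) * τ ^ (1 - p - r))) := by
        rw [h1, hc]; ring
    _ ≤ c * (δ * T ^ (1 - p) + C * (T ^ (1 - p - r) * ε ^ r)) := by gcongr
    _ = η / 2 + c * (C * T ^ (1 - p - r)) * ε ^ r := by
        rw [hδ]; field_simp
    _ ≤ η := by linarith

/-! ### Forces with a time average -/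

/-- The accumulated deviation of the force from its average. -/
def accumulated (f : ℝ → Coeffs) (f₀ : Coeffs) (t : ℝ) : Coeffs :=
  fun k => ∫ s in (0 : ℝ)..max 0 t, (f s k - f₀ k)

lemma accumulated_zero (f : ℝ → Coeffs) (f₀ : Coeffs) : accumulated f f₀ 0 = 0 := by
  ext k; simp [accumulated]

lemma HasTimeAverage.intervalIntegrable {κ γ : ℝ} {f : ℝ → Coeffs} {f₀ : Coeffs}
    (hf : HasTimeAverage κ γ f f₀) (k : Freq) {a b : ℝ} (ha : 0 ≤ a) (hb : 0 ≤ b) :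
    IntervalIntegrable (fun s => f s k) volume a b :=
  (hf.integrable k a ha).symm.trans (hf.integrable k b hb)

lemma HasTimeAverage.continuous_accumulated {κ γ : ℝ} {f : ℝ → Coeffs} {f₀ : Coeffs}
    (hf : HasTimeAverage κ γ f f₀) (k : Freq) :
    Continuous fun t => accumulated f f₀ t k := by
  have hc : ContinuousOn (fun t => ∫ s in (0 : ℝ)..t, (f s k - f₀ k)) (Set.Ici 0) := by
    intro t ht
    have ht : 0 ≤ t := ht
    have h1 := intervalIntegral.continuousOn_primitive_interval'
      (f := fun s => f s k - f₀ k) (μ := volume) (b₁ := 0) (b₂ := t + 1) (a := 0)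
      ((hf.integrable k (t + 1) (by linarith)).sub (intervalIntegrable_const))
      (by simp)
    rw [Set.uIcc_of_le (by linarith)] at h1
    refine (h1 t ⟨ht, by linarith⟩).mono_of_mem_nhdsWithin ?_
    rw [mem_nhdsWithin]
    exact ⟨Set.Iio (t + 1), isOpen_Iio, by simp, fun x hx => ⟨hx.2, hx.1.le⟩⟩
  exact hc.comp_continuous (f := fun t : ℝ => max 0 t) (by fun_prop) fun t => le_max_left 0 t

lemma HasTimeAverage.accumulated_sub {κ γ : ℝ} {f : ℝ → Coeffs} {f₀ : Coeffs}
    (hf : HasTimeAverage κ γ f f₀) {s t : ℝ} (hs : 0 ≤ s) (hst : s < t) (k : Freq) :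
    accumulated f f₀ t k - accumulated f f₀ s k =
      ((t - s : ℝ) : ℂ) * (windowMean f s (t - s) - f₀) k := by
  have ht : 0 ≤ t := hs.trans hst.le
  have hi : ∀ {a b : ℝ}, 0 ≤ a → 0 ≤ b →
      IntervalIntegrable (fun s => f s k - f₀ k) volume a b := fun ha hb =>
    (hf.intervalIntegrable k ha hb).sub intervalIntegrable_const
  simp only [accumulated, windowMean, Pi.sub_apply, max_eq_right hs, max_eq_right ht]
  rw [intervalIntegral.integral_interval_sub_left (hi le_rfl ht) (hi le_rfl hs),
    intervalIntegral.integral_sub (hf.intervalIntegrable k hs ht) intervalIntegrable_const,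
    intervalIntegral.integral_const, add_sub_cancel]
  have : ((t - s : ℝ) : ℂ) ≠ 0 := by exact_mod_cast (sub_pos.2 hst).ne'
  rw [Complex.real_smul, mul_sub, ← mul_assoc]
  congr 1
  rw [Complex.ofReal_div, Complex.ofReal_one, mul_one_div_cancel this, one_mul]

lemma MemDA.finNorm_le {κ γ γ' : ℝ} (hκ : 0 < κ) (hγ : γ' ≤ γ) {c : Coeffs} (hc : MemDA γ c)
    (K : Finset Freq) :
    finNorm K (fun k => ((lam k ^ γ' : ℝ) : ℂ) * c k) ≤ κ ^ (-γ) * normDA κ γ c := by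
  refine Real.sqrt_le_iff.2 ⟨mul_nonneg (by positivity) (Real.sqrt_nonneg _), ?_⟩
  have hpt : ∀ k, ((κ * lam k) ^ γ * ‖c k‖) ^ 2 = (κ ^ γ) ^ 2 * (lam k ^ γ * ‖c k‖) ^ 2 :=
    fun k => by rw [Real.mul_rpow hκ.le (lam_nonneg k)]; ring
  have hs : Summable fun k => ((κ * lam k) ^ γ * ‖c k‖) ^ 2 := by
    simp only [hpt]; exact hc.summable.mul_left _
  rw [mul_pow, normDA, Real.sq_sqrt (tsum_nonneg fun _ => sq_nonneg _)]
  have h1 := mul_le_mul_of_nonneg_left (hs.sum_le_tsum K fun _ _ => sq_nonneg _)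
    (sq_nonneg (κ ^ (-γ)))
  refine le_trans ?_ h1
  rw [Finset.mul_sum]
  refine Finset.sum_le_sum fun k _ => ?_
  rw [hpt, ← mul_assoc, ← mul_pow, ← Real.rpow_add hκ, neg_add_cancel, Real.rpow_zero, one_pow,
    one_mul, norm_mul, Complex.norm_real,
    Real.norm_of_nonneg (Real.rpow_nonneg (lam_nonneg k) _)]
  rcases eq_or_ne k 0 with rfl | hk
  · simp [hc.mean_zero]
  · have := lam_nonneg k
    gcongr
    exact one_le_lam hk

/-- On windows longer than `L₀` the deviation of the mean is below `δ` by the decay of `σ`. On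
shorter ones it is controlled by `M`, and `(L₀ / (t - s)) ^ r ≥ 1` turns `M` into the singular term.
-/
lemma HasTimeAverage.exists_increment_bound {κ γ γ' r : ℝ} {f : ℝ → Coeffs} {f₀ : Coeffs}
    (hf : HasTimeAverage κ γ f f₀) (hκ : 0 < κ) (hγ : γ' ≤ γ) (hr : 0 < r) {δ : ℝ} (hδ : 0 < δ) :
    ∃ C, 0 ≤ C ∧ ∀ K : Finset Freq, ∀ s t, 0 ≤ s → s < t →
      finNorm K (fun k => ((lam k ^ γ' : ℝ) : ℂ) *
        (accumulated f f₀ t k - accumulated f f₀ s k)) ≤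
        (t - s) * (δ + C * (t - s) ^ (-r)) := by
  obtain ⟨M, hM, σ, hσ, hb⟩ := hf.bound
  have hlim : Tendsto (fun L => κ ^ (-γ) * σ L) atTop (𝓝 0) := by
    simpa using hσ.const_mul (κ ^ (-γ))
  obtain ⟨L₁, hL₁⟩ := eventually_atTop.1 (hlim.eventually_le_const hδ)
  set L₀ := max L₁ 1 with hL₀
  have hL₀p : 0 < L₀ := one_pos.trans_le (le_max_right _ _)
  refine ⟨κ ^ (-γ) * M * L₀ ^ r, by positivity, fun K s t hs hst => ?_⟩
  have hL : 0 < t - s := sub_pos.2 hst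
  obtain ⟨hmem, hle⟩ := hb s hs (t - s) hL
  have h1 : finNorm K (fun k => ((lam k ^ γ' : ℝ) : ℂ) *
      (accumulated f f₀ t k - accumulated f f₀ s k)) ≤
      (t - s) * finNorm K (fun k => ((lam k ^ γ' : ℝ) : ℂ) *
        (windowMean f s (t - s) - f₀) k) := by
    refine finNorm_le_mul hL.le fun k => ?_
    rw [hf.accumulated_sub hs hst, mul_left_comm, norm_mul, Complex.norm_real,
      Real.norm_of_nonneg hL.le]
  refine h1.trans (mul_le_mul_of_nonneg_left ?_ hL.le)
  refine (hmem.finNorm_le hκ hγ K).trans ?_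
  have hκp : 0 < κ ^ (-γ) := by positivity
  rcases le_total L₀ (t - s) with h | h
  · have h2 := hL₁ (t - s) ((le_max_left _ _).trans h)
    have h3 : κ ^ (-γ) * normDA κ γ (windowMean f s (t - s) - f₀) ≤ κ ^ (-γ) * σ (t - s) := by
      gcongr; exact hle.trans (min_le_right _ _)
    have h4 : 0 ≤ κ ^ (-γ) * M * L₀ ^ r * (t - s) ^ (-r) := by positivity
    linarith
  · have h3 : κ ^ (-γ) * normDA κ γ (windowMean f s (t - s) - f₀) ≤ κ ^ (-γ) * M := by
      gcongr; exact hle.trans (min_le_left _ _)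
    have h4 : 1 ≤ L₀ ^ r * (t - s) ^ (-r) := by
      rw [Real.rpow_neg hL.le, ← div_eq_mul_inv, one_le_div (by positivity)]
      gcongr
    have h5 : κ ^ (-γ) * M * 1 ≤ κ ^ (-γ) * M * (L₀ ^ r * (t - s) ^ (-r)) := by gcongr
    linarith

/-! ### Bounds for the nonlinear terms -/

lemma norm_vorticityDrift_le (Ω P : SeqSpace) :
    ‖vorticityDrift Ω P‖ ≤ advConst * ‖Ω‖ * ‖Ω‖ + ‖P‖ := by
  refine (norm_add_le _ _).trans ?_
  rw [norm_neg]
  exact add_le_add (norm_adv_apply_le Ω Ω) (norm_derivX_apply_le P)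

lemma norm_smul_derivXInvLap_le (N : ℝ) (Ω : SeqSpace) :
    ‖((N ^ 2 : ℝ) : ℂ) • derivXInvLap Ω‖ ≤ N ^ 2 * ‖Ω‖ := by
  rw [norm_smul, Complex.norm_real, Real.norm_of_nonneg (sq_nonneg N)]
  gcongr
  exact norm_derivXInvLap_apply_le Ω

lemma norm_densityDrift_le (N : ℝ) (Ω P : SeqSpace) :
    ‖densityDrift N Ω P‖ ≤ advConst * ‖Ω‖ * ‖P‖ + N ^ 2 * ‖Ω‖ := by
  refine (norm_add_le _ _).trans ?_
  rw [norm_neg]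
  exact add_le_add (norm_adv_apply_le P Ω) (norm_smul_derivXInvLap_le N Ω)

lemma re_inner_le_norm_mul_norm (a b : SeqSpace) : (inner ℂ a b).re ≤ ‖a‖ * ‖b‖ :=
  (Complex.re_le_norm _).trans (norm_inner_le_norm a b)

/-- Transport of `Θ` by the full velocity does no work; what remains is linear in `‖Θ‖`, so it can
be absorbed by dissipation. -/
lemma re_inner_vorticityDrift_le (Θ G P : SeqSpace)
    (hreal : ∀ k, (Θ + G) (-k) = (starRingEnd ℂ) ((Θ + G) k)) :
    (inner ℂ (invSqrtLap Θ) (vorticityDrift (Θ + G) P)).re ≤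
      ‖invSqrtLap Θ‖ * (advConst * (‖Θ‖ + ‖G‖) * ‖G‖ + ‖P‖) := by
  have e : inner ℂ (invSqrtLap Θ) (vorticityDrift (Θ + G) P) =
      -inner ℂ (invSqrtLap Θ) (adv (Θ + G) Θ) +
        inner ℂ (invSqrtLap Θ) (-adv (Θ + G) G + derivX P) := by
    rw [← inner_neg_right, ← inner_add_right, vorticityDrift, (adv (Θ + G)).map_add]
    congr 1; abel
  rw [e, Complex.add_re, Complex.neg_re, re_inner_adv_eq_zero Θ _ hreal, neg_zero, zero_add]
  refine (re_inner_le_norm_mul_norm _ _).trans ?_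
  gcongr
  refine (norm_add_le _ _).trans ?_
  rw [norm_neg]
  refine add_le_add ((norm_adv_apply_le G _).trans ?_) (norm_derivX_apply_le P)
  have := advConst_nonneg
  gcongr
  exact norm_add_le _ _

lemma re_inner_densityDrift_le (N : ℝ) (Ω P : SeqSpace)
    (hreal : ∀ k, Ω (-k) = (starRingEnd ℂ) (Ω k)) :
    (inner ℂ (invSqrtLap P) (densityDrift N Ω P)).re ≤ ‖invSqrtLap P‖ * (N ^ 2 * ‖Ω‖) := by
  rw [densityDrift, inner_add_right, inner_neg_right, Complex.add_re, Complex.neg_re,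
    re_inner_adv_eq_zero P _ hreal, neg_zero, zero_add]
  refine (re_inner_le_norm_mul_norm _ _).trans ?_
  gcongr
  exact norm_smul_derivXInvLap_le N Ω

lemma two_mul_mul_le_young {t : ℝ} (ht : 0 < t) (a b : ℝ) :
    2 * (a * b) ≤ t * b ^ 2 + a ^ 2 / t := by
  have : t * b ^ 2 + a ^ 2 / t - 2 * (a * b) = (t * b - a) ^ 2 / t := by
    field_simp; ring
  have := div_nonneg (sq_nonneg (t * b - a)) ht.le
  linarith

/-- The growth rate of the energy. -/
def energyRate (N d g : ℝ) : ℝ :=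
  (2 * (advConst * g) ^ 2 + 1 + 2 * N ^ 4) / d + 1 + (advConst * g ^ 2) ^ 2 + (N ^ 2 * g) ^ 2

lemma energyRate_nonneg {N d g : ℝ} (hd : 0 < d) : 0 ≤ energyRate N d g := by
  unfold energyRate; positivity

/-- Of the dissipation `2d`, Young's inequality spends `d`: two portions `d / 2` on `‖Θ‖²` and one
portion `d` on `‖P‖²`. The other terms involve only `L²` norms and `‖G‖`, so Gronwall closes. -/
lemma energy_production_le {ν μ N d : ℝ} (hd : 0 < d) (hν : d ≤ ν) (hμ : d ≤ μ)
    {Θ G P : SeqSpace} (hreal : ∀ k, (Θ + G) (-k) = (starRingEnd ℂ) ((Θ + G) k)) :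
    2 * (-(ν * ‖Θ‖ ^ 2) + (inner ℂ (invSqrtLap Θ) (vorticityDrift (Θ + G) P)).re) +
      2 * (-(μ * ‖P‖ ^ 2) + (inner ℂ (invSqrtLap P) (densityDrift N (Θ + G) P)).re) ≤
      -(d * (‖Θ‖ ^ 2 + ‖P‖ ^ 2)) +
        energyRate N d ‖G‖ * (‖invSqrtLap Θ‖ ^ 2 + ‖invSqrtLap P‖ ^ 2 + 1) := by
  have h1 := re_inner_vorticityDrift_le Θ G P hreal
  have h2 := re_inner_densityDrift_le N (Θ + G) P hreal
  have h3 : ‖invSqrtLap P‖ * (N ^ 2 * ‖Θ + G‖) ≤ ‖invSqrtLap P‖ * (N ^ 2 * (‖Θ‖ + ‖G‖)) := by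
    gcongr; exact norm_add_le _ _
  have h4 : d * ‖Θ‖ ^ 2 ≤ ν * ‖Θ‖ ^ 2 := by gcongr
  have h5 : d * ‖P‖ ^ 2 ≤ μ * ‖P‖ ^ 2 := by gcongr
  set x := ‖invSqrtLap Θ‖
  set y := ‖invSqrtLap P‖
  set g := ‖G‖
  set c := advConst
  have y1 := two_mul_mul_le_young (half_pos hd) (x * (c * g)) ‖Θ‖
  have y2 := two_mul_mul_le_young one_pos x (c * g ^ 2)
  have y3 := two_mul_mul_le_young hd x ‖P‖
  have y4 := two_mul_mul_le_young (half_pos hd) (y * N ^ 2) ‖Θ‖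
  have y5 := two_mul_mul_le_young one_pos y (N ^ 2 * g)
  have e1 : (x * (c * g)) ^ 2 / (d / 2) = 2 * (c * g) ^ 2 / d * x ^ 2 := by field_simp
  have e2 : (y * N ^ 2) ^ 2 / (d / 2) = 2 * N ^ 4 / d * y ^ 2 := by field_simp
  have e3 : x ^ 2 / d = 1 / d * x ^ 2 := by ring
  rw [e1] at y1; rw [e2] at y4; rw [e3] at y3
  have e4 : energyRate N d g * (x ^ 2 + y ^ 2 + 1) =
      (2 * (c * g) ^ 2 / d * x ^ 2 + 2 * N ^ 4 / d * y ^ 2 + 1 / d * x ^ 2 + x ^ 2 + y ^ 2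
        + (c * g ^ 2) ^ 2 + (N ^ 2 * g) ^ 2) +
      (2 * (c * g) ^ 2 / d * (y ^ 2 + 1) + 2 * N ^ 4 / d * (x ^ 2 + 1) + 1 / d * (y ^ 2 + 1) + 1 +
        ((c * g ^ 2) ^ 2 + (N ^ 2 * g) ^ 2) * (x ^ 2 + y ^ 2)) := by
    unfold energyRate; ring
  have e5 : 0 ≤ 2 * (c * g) ^ 2 / d * (y ^ 2 + 1) + 2 * N ^ 4 / d * (x ^ 2 + 1) +
      1 / d * (y ^ 2 + 1) + 1 + ((c * g ^ 2) ^ 2 + (N ^ 2 * g) ^ 2) * (x ^ 2 + y ^ 2) := by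
    positivity
  rw [e4]
  linarith

/-- The growth rate of the enstrophy gradient. -/
def palinstrophyRate (N d g y : ℝ) : ℝ :=
  (1 + g ^ 2) / d * (4 * advConst ^ 2 * (y + g ^ 2) + 2 + 2 * N ^ 4)

/-- The drift is quadratic, so its square is quartic. It is arranged as a rate affine in `‖Θ‖² +
‖P‖²` times the quantity to be bounded, because the time integral of that rate is known from the
energy. -/
lemma drift_norm_sq_le {N d : ℝ} (hd : 0 < d) (Θ G P : SeqSpace) :
    1 / (2 * d) * (‖vorticityDrift (Θ + G) P‖ ^ 2 + ‖densityDrift N (Θ + G) P‖ ^ 2) ≤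
      palinstrophyRate N d ‖G‖ (‖Θ‖ ^ 2 + ‖P‖ ^ 2) * (‖Θ‖ ^ 2 + ‖P‖ ^ 2 + 1) := by
  set w := ‖Θ + G‖
  set c := advConst
  set g := ‖G‖
  have hc : 0 ≤ c := advConst_nonneg
  have hw : w ^ 2 ≤ 2 * (‖Θ‖ ^ 2 + g ^ 2) := by
    have : w ≤ ‖Θ‖ + g := norm_add_le _ _
    nlinarith [norm_nonneg (Θ + G), sq_nonneg (‖Θ‖ - g), norm_nonneg Θ, norm_nonneg G]
  have h1 : ‖vorticityDrift (Θ + G) P‖ ^ 2 ≤ 2 * c ^ 2 * w ^ 2 * w ^ 2 + 2 * ‖P‖ ^ 2 := by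
    have : ‖vorticityDrift (Θ + G) P‖ ^ 2 ≤ (c * w * w + ‖P‖) ^ 2 := by
      gcongr; exact norm_vorticityDrift_le _ _
    nlinarith [sq_nonneg (c * w * w - ‖P‖)]
  have h2 : ‖densityDrift N (Θ + G) P‖ ^ 2 ≤
      2 * c ^ 2 * w ^ 2 * ‖P‖ ^ 2 + 2 * N ^ 4 * w ^ 2 := by
    have : ‖densityDrift N (Θ + G) P‖ ^ 2 ≤ (c * w * ‖P‖ + N ^ 2 * w) ^ 2 := by
      gcongr; exact norm_densityDrift_le _ _ _
    nlinarith [sq_nonneg (c * w * ‖P‖ - N ^ 2 * w)]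
  set y := ‖Θ‖ ^ 2 + ‖P‖ ^ 2 with hy
  have hy0 : 0 ≤ y := by positivity
  have hP : 0 ≤ ‖P‖ ^ 2 := sq_nonneg _
  have h3 : w ^ 2 + ‖P‖ ^ 2 ≤ 2 * (1 + g ^ 2) * (y + 1) := by
    nlinarith [mul_nonneg (sq_nonneg g) hy0]
  have h4 : w ^ 2 ≤ 2 * (y + g ^ 2) := by linarith
  have h5 : ‖vorticityDrift (Θ + G) P‖ ^ 2 + ‖densityDrift N (Θ + G) P‖ ^ 2 ≤
      (2 * c ^ 2 * w ^ 2 + 2 + 2 * N ^ 4) * (w ^ 2 + ‖P‖ ^ 2) := by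
    have : 0 ≤ 2 * w ^ 2 + 2 * N ^ 4 * ‖P‖ ^ 2 := by positivity
    linarith
  calc _ ≤ 1 / (2 * d) * ((2 * c ^ 2 * (2 * (y + g ^ 2)) + 2 + 2 * N ^ 4) *
        (2 * (1 + g ^ 2) * (y + 1))) := by
        gcongr
        exact h5.trans (by gcongr)
    _ = _ := by
        unfold palinstrophyRate
        field_simp
        ring

/-! ### The averaged system -/

/-- The stationary response `(-ν Δ)⁻¹ f₀` lies in `H¹`. -/
lemma MemDA.exists_stationary {ν γ : ℝ} (hν : 0 < ν) (hγ : -(1 / 2) < γ) {f₀ : Coeffs}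
    (hf : MemDA γ f₀) : ∃ G : SeqSpace, G 0 = 0 ∧
      ∀ k, ((ν * lam k : ℝ) : ℂ) * G k = (√(lam k) : ℂ) * f₀ k := by
  have hG : Memℓp (fun k => ((ν⁻¹ * (√(lam k))⁻¹ : ℝ) : ℂ) * f₀ k) 2 := by
    rw [memlp_iff_summable]
    refine (hf.summable.mul_left ((ν⁻¹) ^ 2)).of_nonneg_of_le (fun _ => sq_nonneg _) fun k => ?_
    rw [← mul_pow, norm_mul, Complex.norm_real, Real.norm_of_nonneg (by positivity), mul_assoc]
    rcases eq_or_ne k 0 with rfl | hk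
    · simp [hf.mean_zero]
    gcongr
    -- The lower bound on `γ` enters: `λ^(-1/2) ≤ λ^γ` for `λ ≥ 1`.
    rw [Real.sqrt_eq_rpow, ← Real.rpow_neg (lam_nonneg k)]
    exact Real.rpow_le_rpow_of_exponent_le (one_le_lam hk) hγ.le
  refine ⟨⟨_, hG⟩, by simp, fun k => ?_⟩
  rcases eq_or_ne k 0 with rfl | hk
  · simp
  have : (√(lam k) : ℂ) ≠ 0 := by
    exact_mod_cast (Real.sqrt_pos.2 (lam_pos hk)).ne'
  have hν' : (ν : ℂ) ≠ 0 := by exact_mod_cast hν.ne'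
  have h2 : (√(lam k) : ℂ) * √(lam k) = lam k := by
    exact_mod_cast Real.mul_self_sqrt (lam_nonneg k)
  push_cast
  rw [← h2]
  field_simp

/-- The force `f₀` need not be in `L²`, so it is not an admissible source for the `H¹` estimate;
subtracting the stationary response removes it. -/
lemma IsModeSolution.sub_stationary {ν μ N ε S : ℝ} {f₀ : Coeffs} {Ω P : ℝ → SeqSpace}
    (h : IsModeSolution ν μ N ε S (fun _ => f₀) Ω P) {G : SeqSpace}
    (hG : ∀ k, ((ν * lam k : ℝ) : ℂ) * G k = (√(lam k) : ℂ) * f₀ k) :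
    ∀ τ ∈ Set.Icc 0 S, ∀ k, (Ω τ - G) k = (Ω 0 - G) k + ∫ s in (0 : ℝ)..τ, (ε : ℂ) *
      (-(ν * lam k : ℝ) * (Ω s - G) k + (√(lam k) : ℂ) * vorticityDrift (Ω s) (P s) k) := by
  intro τ hτ k
  have h1 := continuous_eval h.cont_vorticity k
  have h2 := continuous_eval (Continuous.vorticityDrift h.cont_vorticity h.cont_density) k
  have e : ∀ s, (ε : ℂ) * (-(ν * lam k : ℝ) * (Ω s - G) k +
      (√(lam k) : ℂ) * vorticityDrift (Ω s) (P s) k) = (ε : ℂ) *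
      (-(ν * lam k : ℝ) * Ω s k + (√(lam k) : ℂ) * vorticityDrift (Ω s) (P s) k) +
      ε * (√(lam k) : ℂ) * f₀ k := fun s => by
    rw [lp.coeFn_sub, Pi.sub_apply]
    linear_combination (ε : ℂ) * hG k
  simp only [e]
  rw [intervalIntegral.integral_add (Continuous.intervalIntegrable (by fun_prop) _ _)
    (Continuous.intervalIntegrable (by fun_prop) _ _), intervalIntegral.integral_const_mul
    (ε * (√(lam k) : ℂ)), lp.coeFn_sub, lp.coeFn_sub, Pi.sub_apply, Pi.sub_apply,
    h.eq_vorticity τ hτ k]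
  ring

/-- Two Gronwall arguments are nested. The inner exponential bounds the `L²` energy; the quotient by
`d` is the resulting bound for the accumulated dissipation, which enters the exponent of the `H¹`
bound. -/
lemma IsModeSolution.norm_sq_le {ν μ N d ε S T : ℝ} (hd : 0 < d) (hν : d ≤ ν) (hμ : d ≤ μ)
    (hε : 0 < ε) (hST : S ≤ T / ε) {f₀ : Coeffs} {Ω P : ℝ → SeqSpace}
    (h : IsModeSolution ν μ N ε S (fun _ => f₀) Ω P) {G : SeqSpace} (hG0 : G 0 = 0)
    (hG : ∀ k, ((ν * lam k : ℝ) : ℂ) * G k = (√(lam k) : ℂ) * f₀ k) {A : ℝ}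
    (hA : ‖Ω 0 - G‖ ^ 2 + ‖P 0‖ ^ 2 + 1 ≤ A) {τ : ℝ} (hτ : τ ∈ Set.Icc 0 S) :
    ‖Ω τ - G‖ ^ 2 + ‖P τ‖ ^ 2 + 1 ≤ A * Real.exp ((1 + ‖G‖ ^ 2) / d * (4 * advConst ^ 2 *
      ((A + energyRate N d ‖G‖ * (A * Real.exp (energyRate N d ‖G‖ * T)) * T) / d) +
        (4 * advConst ^ 2 * ‖G‖ ^ 2 + 2 + 2 * N ^ 4) * T)) := by
  set Θ : ℝ → SeqSpace := fun s => Ω s - G with hΘ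
  have hΩ : ∀ s, Ω s = Θ s + G := fun s => (sub_add_cancel _ _).symm
  have hΘc : Continuous Θ := h.cont_vorticity.sub continuous_const
  have hPc := h.cont_density
  have hΘ0 : ∀ s, Θ s 0 = 0 := fun s => by
    simp [hΘ, h.zero_vorticity, hG0]
  have hreal : ∀ s k, (Θ s + G) (-k) = (starRingEnd ℂ) ((Θ s + G) k) := fun s k => by
    rw [← hΩ]; exact h.real_vorticity s k
  have heqΘ := h.sub_stationary hG
  have hn := Continuous.vorticityDrift h.cont_vorticity h.cont_density
  have hm := Continuous.densityDrift N h.cont_vorticity h.cont_density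
  set k₀ := energyRate N d ‖G‖
  have hk₀ : 0 ≤ k₀ := energyRate_nonneg hd
  have hA0 : 0 ≤ A := le_trans (by positivity) hA
  have hετ : ∀ t ∈ Set.Icc 0 S, ε * t ≤ T := fun t ht => by
    have := ht.2.trans hST
    rwa [le_div_iff₀ hε, mul_comm] at this
  have hDΘc : Continuous fun s => invSqrtLap (Θ s) := invSqrtLap.continuous.comp hΘc
  have hDPc : Continuous fun s => invSqrtLap (P s) := invSqrtLap.continuous.comp hPc
  set z : ℝ → ℝ := fun s => ‖invSqrtLap (Θ s)‖ ^ 2 + ‖invSqrtLap (P s)‖ ^ 2 + 1 with hz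
  have hzc : Continuous z := by fun_prop
  set y : ℝ → ℝ := fun s => ‖Θ s‖ ^ 2 + ‖P s‖ ^ 2 with hy
  have hyc : Continuous y := by fun_prop
  have hz0 : z 0 ≤ A := by
    refine le_trans ?_ hA
    simp only [hz]
    gcongr <;> exact norm_invSqrtLap_apply_le _
  have henergy : ∀ t ∈ Set.Icc 0 S,
      z t + ∫ s in (0 : ℝ)..t, ε * d * y s ≤ A + ∫ s in (0 : ℝ)..t, ε * k₀ * z s := by
    intro t ht
    have e1 := norm_invSqrtLap_sq_eq (hd.le.trans hν) hε.le hn hΘc hΘ0 heqΘ ht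
    have e2 := norm_invSqrtLap_sq_eq (hd.le.trans hμ) hε.le hm hPc h.zero_density
      h.eq_density ht
    have i1 : Continuous fun s => 2 * ε * (-(ν * ‖Θ s‖ ^ 2) +
        (inner ℂ (invSqrtLap (Θ s)) (vorticityDrift (Ω s) (P s))).re) :=
      continuous_const.mul ((continuous_const.mul (hΘc.norm.pow 2)).neg.add
        (Complex.continuous_re.comp (hDΘc.inner hn)))
    have i2 : Continuous fun s => 2 * ε * (-(μ * ‖P s‖ ^ 2) +
        (inner ℂ (invSqrtLap (P s)) (densityDrift N (Ω s) (P s))).re) :=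
      continuous_const.mul ((continuous_const.mul (hPc.norm.pow 2)).neg.add
        (Complex.continuous_re.comp (hDPc.inner hm)))
    have e3 : z t = z 0 + ∫ s in (0 : ℝ)..t, (2 * ε * (-(ν * ‖Θ s‖ ^ 2) +
        (inner ℂ (invSqrtLap (Θ s)) (vorticityDrift (Ω s) (P s))).re) +
        2 * ε * (-(μ * ‖P s‖ ^ 2) +
        (inner ℂ (invSqrtLap (P s)) (densityDrift N (Ω s) (P s))).re)) := by
      rw [intervalIntegral.integral_add (i1.intervalIntegrable _ _) (i2.intervalIntegrable _ _)]
      simp only [hz]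
      linarith
    have e4 : ∫ s in (0 : ℝ)..t, (2 * ε * (-(ν * ‖Θ s‖ ^ 2) +
        (inner ℂ (invSqrtLap (Θ s)) (vorticityDrift (Ω s) (P s))).re) +
        2 * ε * (-(μ * ‖P s‖ ^ 2) +
        (inner ℂ (invSqrtLap (P s)) (densityDrift N (Ω s) (P s))).re)) ≤
        ∫ s in (0 : ℝ)..t, (ε * k₀ * z s - ε * d * y s) := by
      refine intervalIntegral.integral_mono ht.1 ((i1.add i2).intervalIntegrable _ _)
        (Continuous.intervalIntegrable (by fun_prop) _ _) fun s => ?_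
      have := mul_le_mul_of_nonneg_left
        (energy_production_le (N := N) hd hν hμ (Θ := Θ s) (G := G) (P := P s) (hreal s)) hε.le
      rw [← hΩ] at this
      simp only [hz, hy]
      linarith
    rw [intervalIntegral.integral_sub (Continuous.intervalIntegrable (by fun_prop) _ _)
      (Continuous.intervalIntegrable (by fun_prop) _ _)] at e4
    linarith
  have hzle : ∀ t ∈ Set.Icc 0 S, z t ≤ A * Real.exp (k₀ * T) := by
    intro t ht
    have h1 := le_mul_exp_integral (u := z) (b := fun _ => ε * k₀) (A := A) (S := S) hzc
      continuous_const (fun _ => by positivity) (fun t ht => ?_) ht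
    · refine h1.trans ?_
      rw [intervalIntegral.integral_const, sub_zero, smul_eq_mul]
      refine mul_le_mul_of_nonneg_left (Real.exp_le_exp.2 ?_) hA0
      calc t * (ε * k₀) = k₀ * (ε * t) := by ring
        _ ≤ k₀ * T := by gcongr; exact hετ t ht
    · have h2 := henergy t ht
      have h3 : 0 ≤ ∫ s in (0 : ℝ)..t, ε * d * y s :=
        intervalIntegral.integral_nonneg ht.1 fun s _ => by positivity
      linarith
  -- The dissipation, dropped in `hzle`, is now retained and the energy bounded from above.
  have hydiss : ∀ t ∈ Set.Icc 0 S,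
      ∫ s in (0 : ℝ)..t, ε * y s ≤ (A + k₀ * (A * Real.exp (k₀ * T)) * T) / d := by
    intro t ht
    have h2 := henergy t ht
    have h3 : ∫ s in (0 : ℝ)..t, ε * k₀ * z s ≤
        ∫ s in (0 : ℝ)..t, ε * k₀ * (A * Real.exp (k₀ * T)) := by
      refine intervalIntegral.integral_mono_on ht.1
        (Continuous.intervalIntegrable (by fun_prop) _ _)
        (Continuous.intervalIntegrable (by fun_prop) _ _) fun s hs => ?_
      have := hzle s ⟨hs.1, hs.2.trans ht.2⟩
      gcongr
    rw [intervalIntegral.integral_const, sub_zero, smul_eq_mul] at h3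
    have h4 : t * (ε * k₀ * (A * Real.exp (k₀ * T))) ≤ k₀ * (A * Real.exp (k₀ * T)) * T := by
      calc _ = k₀ * (A * Real.exp (k₀ * T)) * (ε * t) := by ring
        _ ≤ _ := by gcongr; exact hετ t ht
    have h5 : 0 ≤ z t := by positivity
    have h6 : ∫ s in (0 : ℝ)..t, ε * d * y s = d * ∫ s in (0 : ℝ)..t, ε * y s := by
      rw [← intervalIntegral.integral_const_mul]; congr 1; ext s; ring
    rw [le_div_iff₀ hd, mul_comm]
    linarith
  have hgrow : ∀ t ∈ Set.Icc 0 S, y t + 1 ≤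
      A + ∫ s in (0 : ℝ)..t, ε * palinstrophyRate N d ‖G‖ (y s) * (y s + 1) := by
    intro t ht
    have e1 := norm_sq_le_add_integral (hd.trans_le hν) hε.le hn hΘc heqΘ ht
    have e2 := norm_sq_le_add_integral (hd.trans_le hμ) hε.le hm hPc h.eq_density ht
    have i1 : Continuous fun s => ε / (2 * ν) * ‖vorticityDrift (Ω s) (P s)‖ ^ 2 := by fun_prop
    have i2 : Continuous fun s => ε / (2 * μ) * ‖densityDrift N (Ω s) (P s)‖ ^ 2 := by fun_prop
    have e3 : ∫ s in (0 : ℝ)..t, (ε / (2 * ν) * ‖vorticityDrift (Ω s) (P s)‖ ^ 2 +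
        ε / (2 * μ) * ‖densityDrift N (Ω s) (P s)‖ ^ 2) ≤
        ∫ s in (0 : ℝ)..t, ε * palinstrophyRate N d ‖G‖ (y s) * (y s + 1) := by
      refine intervalIntegral.integral_mono ht.1 ((i1.add i2).intervalIntegrable _ _)
        (Continuous.intervalIntegrable (by unfold palinstrophyRate; fun_prop) _ _) fun s => ?_
      have h1 := drift_norm_sq_le (N := N) hd (Θ s) G (P s)
      rw [← hΩ] at h1
      have h2 := mul_le_mul_of_nonneg_left h1 hε.le
      have h3 : ε / (2 * ν) * ‖vorticityDrift (Ω s) (P s)‖ ^ 2 +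
          ε / (2 * μ) * ‖densityDrift N (Ω s) (P s)‖ ^ 2 ≤
          ε / (2 * d) * ‖vorticityDrift (Ω s) (P s)‖ ^ 2 +
          ε / (2 * d) * ‖densityDrift N (Ω s) (P s)‖ ^ 2 := by gcongr
      refine h3.trans (le_trans (le_of_eq ?_) (h2.trans (le_of_eq ?_)))
      · ring
      · simp only [hy]; ring
    rw [intervalIntegral.integral_add (i1.intervalIntegrable _ _)
      (i2.intervalIntegrable _ _)] at e3
    simp only [hy] at e3 ⊢
    linarith
  have hrate0 : ∀ s, 0 ≤ ε * palinstrophyRate N d ‖G‖ (y s) := fun s => by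
    have : 0 ≤ y s := by positivity
    unfold palinstrophyRate; positivity
  have hfin := le_mul_exp_integral (u := fun s => y s + 1)
    (b := fun s => ε * palinstrophyRate N d ‖G‖ (y s)) (by fun_prop)
    (by unfold palinstrophyRate; fun_prop) hrate0 hgrow hτ
  refine hfin.trans ?_
  gcongr
  have e : ∀ s, ε * palinstrophyRate N d ‖G‖ (y s) = (1 + ‖G‖ ^ 2) / d * (4 * advConst ^ 2) *
      (ε * y s) + (1 + ‖G‖ ^ 2) / d * (4 * advConst ^ 2 * ‖G‖ ^ 2 + 2 + 2 * N ^ 4) * ε :=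
    fun s => by unfold palinstrophyRate; ring
  simp only [e]
  rw [intervalIntegral.integral_add (Continuous.intervalIntegrable (by fun_prop) _ _)
    (Continuous.intervalIntegrable (by fun_prop) _ _), intervalIntegral.integral_const_mul,
    intervalIntegral.integral_const, sub_zero, smul_eq_mul]
  calc _ = (1 + ‖G‖ ^ 2) / d * (4 * advConst ^ 2 * (∫ s in (0 : ℝ)..τ, ε * y s) +
        (4 * advConst ^ 2 * ‖G‖ ^ 2 + 2 + 2 * N ^ 4) * (ε * τ)) := by ring
    _ ≤ _ := by
      gcongr
      · exact hydiss τ hτ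
      · exact hετ τ hτ

/-- Solutions of the averaged system are bounded in `H¹` on time intervals of length `T / ε`. -/
theorem exists_norm_bound {ν μ N γ T : ℝ} (hν : 0 < ν) (hμ : 0 < μ) (hγ : -(1 / 2) < γ)
    {f₀ : Coeffs} (hf : MemDA γ f₀) (A : ℝ) :
    ∃ R, 0 ≤ R ∧ ∀ ε, 0 < ε → ∀ S, S ≤ T / ε → ∀ Ω P : ℝ → SeqSpace,
      IsModeSolution ν μ N ε S (fun _ => f₀) Ω P → ‖Ω 0‖ ≤ A → ‖P 0‖ ≤ A →
      ∀ τ ∈ Set.Icc 0 S, ‖Ω τ‖ ≤ R ∧ ‖P τ‖ ≤ R := by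
  obtain ⟨G, hG0, hG⟩ := hf.exists_stationary hν hγ
  set d := min ν μ
  have hd : 0 < d := lt_min hν hμ
  set A' := (A + ‖G‖) ^ 2 + A ^ 2 + 1
  set Q := A' * Real.exp ((1 + ‖G‖ ^ 2) / d * (4 * advConst ^ 2 *
      ((A' + energyRate N d ‖G‖ * (A' * Real.exp (energyRate N d ‖G‖ * T)) * T) / d) +
        (4 * advConst ^ 2 * ‖G‖ ^ 2 + 2 + 2 * N ^ 4) * T)) with hQ
  have hQ0 : 0 ≤ Q := by positivity
  -- `x² ≤ Q` implies `x ≤ Q + 1`, which avoids a square root; `‖G‖` puts the stationary part back.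
  refine ⟨Q + 1 + ‖G‖, by positivity, fun ε hε S hST Ω P h hΩ hP τ hτ => ?_⟩
  have hA : ‖Ω 0 - G‖ ^ 2 + ‖P 0‖ ^ 2 + 1 ≤ A' := by
    have : ‖Ω 0 - G‖ ≤ A + ‖G‖ := (norm_sub_le _ _).trans (by gcongr)
    change _ ≤ (A + ‖G‖) ^ 2 + A ^ 2 + 1
    gcongr
  have hmain := h.norm_sq_le hd (min_le_left _ _) (min_le_right _ _) hε hST hG0 hG hA hτ
  rw [← hQ] at hmain
  have h1 : ‖Ω τ - G‖ ≤ Q + 1 := by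
    nlinarith [norm_nonneg (Ω τ - G), sq_nonneg ‖P τ‖, sq_nonneg (‖Ω τ - G‖ - 1)]
  have h2 : ‖P τ‖ ≤ Q + 1 := by
    nlinarith [norm_nonneg (P τ), sq_nonneg ‖Ω τ - G‖, sq_nonneg (‖P τ‖ - 1)]
  refine ⟨?_, h2.trans (by linarith [norm_nonneg G])⟩
  calc ‖Ω τ‖ = ‖(Ω τ - G) + G‖ := by rw [sub_add_cancel]
    _ ≤ ‖Ω τ - G‖ + ‖G‖ := norm_add_le _ _
    _ ≤ _ := by gcongr

/-! ### The difference of two solutions -/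

lemma norm_vorticityDrift_sub_le {Ω P Ω' P' : SeqSpace} {B : ℝ} (hΩ : ‖Ω‖ ≤ B)
    (hΩ' : ‖Ω'‖ ≤ B) :
    ‖vorticityDrift Ω P - vorticityDrift Ω' P'‖ ≤
      2 * advConst * B * ‖Ω - Ω'‖ + ‖P - P'‖ := by
  have e : vorticityDrift Ω P - vorticityDrift Ω' P' =
      -(adv (Ω - Ω') Ω + adv Ω' (Ω - Ω')) + derivX (P - P') := by
    simp only [vorticityDrift, map_sub, sub_apply]
    abel
  have hc := advConst_nonneg
  rw [e]
  refine (norm_add_le _ _).trans (add_le_add ?_ (norm_derivX_apply_le _))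
  rw [norm_neg]
  refine (norm_add_le _ _).trans ((add_le_add (norm_adv_apply_le _ _)
    (norm_adv_apply_le _ _)).trans ?_)
  calc _ ≤ advConst * ‖Ω - Ω'‖ * B + advConst * B * ‖Ω - Ω'‖ := by gcongr
    _ = _ := by ring

lemma norm_densityDrift_sub_le (N : ℝ) {Ω P Ω' P' : SeqSpace} {B : ℝ} (hP : ‖P‖ ≤ B)
    (hΩ' : ‖Ω'‖ ≤ B) :
    ‖densityDrift N Ω P - densityDrift N Ω' P'‖ ≤
      (advConst * B + N ^ 2) * ‖Ω - Ω'‖ + advConst * B * ‖P - P'‖ := by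
  have e : densityDrift N Ω P - densityDrift N Ω' P' =
      -(adv (Ω - Ω') P + adv Ω' (P - P')) + ((N ^ 2 : ℝ) : ℂ) • derivXInvLap (Ω - Ω') := by
    simp only [densityDrift, map_sub, sub_apply, smul_sub]
    abel
  have hc := advConst_nonneg
  rw [e]
  refine (norm_add_le _ _).trans ((add_le_add_left ((norm_neg _).le.trans ((norm_add_le _ _).trans
    (add_le_add (norm_adv_apply_le _ _) (norm_adv_apply_le _ _)))) _).trans ?_)
  have h1 := norm_smul_derivXInvLap_le N (Ω - Ω')
  have h2 : advConst * ‖Ω - Ω'‖ * ‖P‖ ≤ advConst * ‖Ω - Ω'‖ * B := by gcongr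
  have h3 : advConst * ‖Ω'‖ * ‖P - P'‖ ≤ advConst * B * ‖P - P'‖ := by gcongr
  linarith

/-- The Lipschitz constant of the drift on the ball of radius `B`. -/
def driftLip (N B : ℝ) : ℝ := 2 * advConst * B + 1 + N ^ 2

lemma drift_sub_sq_le (N : ℝ) {Ω P Ω' P' : SeqSpace} {B : ℝ} (hB : 0 ≤ B) (hΩ : ‖Ω‖ ≤ B)
    (hP : ‖P‖ ≤ B) (hΩ' : ‖Ω'‖ ≤ B) :
    ‖vorticityDrift Ω P - vorticityDrift Ω' P'‖ ^ 2 +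
      ‖densityDrift N Ω P - densityDrift N Ω' P'‖ ^ 2 ≤
      4 * driftLip N B ^ 2 * (‖Ω - Ω'‖ ^ 2 + ‖P - P'‖ ^ 2) := by
  have h1 := norm_vorticityDrift_sub_le (P := P) (P' := P') hΩ hΩ'
  have h2 := norm_densityDrift_sub_le N (Ω := Ω) (P' := P') hP hΩ'
  have hcB : 0 ≤ advConst * B := mul_nonneg advConst_nonneg hB
  set u := ‖Ω - Ω'‖
  set r := ‖P - P'‖
  have hu : 0 ≤ u := norm_nonneg _
  have hr : 0 ≤ r := norm_nonneg _
  have hN := sq_nonneg N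
  have h3 : 2 * advConst * B * u + r ≤ driftLip N B * (u + r) := by
    have : 0 ≤ (1 + N ^ 2) * u + (2 * (advConst * B) + N ^ 2) * r := by positivity
    unfold driftLip; linarith
  have h4 : (advConst * B + N ^ 2) * u + advConst * B * r ≤ driftLip N B * (u + r) := by
    have : 0 ≤ (advConst * B + 1) * u + (advConst * B + 1 + N ^ 2) * r := by positivity
    unfold driftLip; linarith
  have h5 : (driftLip N B * (u + r)) ^ 2 ≤ 2 * driftLip N B ^ 2 * (u ^ 2 + r ^ 2) := by
    have := mul_nonneg (sq_nonneg (driftLip N B)) (sq_nonneg (u - r))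
    linarith
  have h6 : ‖vorticityDrift Ω P - vorticityDrift Ω' P'‖ ^ 2 ≤ (driftLip N B * (u + r)) ^ 2 := by
    gcongr; exact h1.trans h3
  have h7 : ‖densityDrift N Ω P - densityDrift N Ω' P'‖ ^ 2 ≤ (driftLip N B * (u + r)) ^ 2 := by
    gcongr; exact h2.trans h4
  linarith

section Difference

variable {ν μ N ε S κ γ : ℝ} {f : ℝ → Coeffs} {f₀ : Coeffs} {Ω P Ω' P' : ℝ → SeqSpace}

/-- The response carries all of `f - f₀`; by linearity only the difference of the drifts is left as
source. -/
lemma vorticity_sub_response_eq (hf : HasTimeAverage κ γ f f₀)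
    (h : IsModeSolution ν μ N ε S f Ω P) (h' : IsModeSolution ν μ N ε S (fun _ => f₀) Ω' P')
    (h0 : Ω 0 = Ω' 0) {τ : ℝ} (hτ : τ ∈ Set.Icc 0 S) (k : Freq) :
    Ω τ k - Ω' τ k - (√(lam k) : ℂ) *
        heatResponse ε (ε * ν * lam k) (fun t => accumulated f f₀ t k) τ =
      ∫ s in (0 : ℝ)..τ, (ε : ℂ) * (-(ν * lam k : ℝ) * (Ω s k - Ω' s k - (√(lam k) : ℂ) *
        heatResponse ε (ε * ν * lam k) (fun t => accumulated f f₀ t k) s) +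
        (√(lam k) : ℂ) * (vorticityDrift (Ω s) (P s) - vorticityDrift (Ω' s) (P' s)) k) := by
  have hG := hf.continuous_accumulated k
  have hR := continuous_heatResponse ε (ε * ν * lam k) hG
  have hΩ := continuous_eval h.cont_vorticity k
  have hΩ' := continuous_eval h'.cont_vorticity k
  have hn := continuous_eval (Continuous.vorticityDrift h.cont_vorticity h.cont_density) k
  have hn' := continuous_eval (Continuous.vorticityDrift h'.cont_vorticity h'.cont_density) k
  have e : ∀ s, (ε : ℂ) * (-(ν * lam k : ℝ) * (Ω s k - Ω' s k - (√(lam k) : ℂ) *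
        heatResponse ε (ε * ν * lam k) (fun t => accumulated f f₀ t k) s) +
        (√(lam k) : ℂ) * (vorticityDrift (Ω s) (P s) - vorticityDrift (Ω' s) (P' s)) k) =
      ((ε : ℂ) * (-(ν * lam k : ℝ) * Ω s k + (√(lam k) : ℂ) * vorticityDrift (Ω s) (P s) k) -
      (ε : ℂ) * (-(ν * lam k : ℝ) * Ω' s k + (√(lam k) : ℂ) * vorticityDrift (Ω' s) (P' s) k)) +
      (√(lam k) : ℂ) * (ε * ν * lam k : ℝ) *
        heatResponse ε (ε * ν * lam k) (fun t => accumulated f f₀ t k) s := fun s => by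
    rw [lp.coeFn_sub, Pi.sub_apply]; push_cast; ring
  have ha : accumulated f f₀ τ k =
      (∫ s in (0 : ℝ)..τ, f s k) - ∫ _ in (0 : ℝ)..τ, f₀ k := by
    rw [accumulated, max_eq_right hτ.1, intervalIntegral.integral_sub
      (hf.integrable k τ hτ.1) intervalIntegrable_const]
  simp only [e]
  rw [intervalIntegral.integral_add (Continuous.intervalIntegrable (by fun_prop) _ _)
    (Continuous.intervalIntegrable (by fun_prop) _ _),
    intervalIntegral.integral_sub (Continuous.intervalIntegrable (by fun_prop) _ _)
    (Continuous.intervalIntegrable (by fun_prop) _ _), intervalIntegral.integral_const_mul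
    ((√(lam k) : ℂ) * (ε * ν * lam k : ℝ)), h.eq_vorticity τ hτ k, h'.eq_vorticity τ hτ k, h0]
  have hv := heatResponse_eq_integral ε (ε * ν * lam k) hG τ
  rw [hv, ha]
  ring

lemma norm_vorticity_sub_sq_le (hν : 0 < ν) (hε : 0 ≤ ε) (hf : HasTimeAverage κ γ f f₀)
    (h : IsModeSolution ν μ N ε S f Ω P) (h' : IsModeSolution ν μ N ε S (fun _ => f₀) Ω' P')
    (h0 : Ω 0 = Ω' 0) {δ : ℝ} {τ : ℝ} (hτ : τ ∈ Set.Icc 0 S)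
    (hδ : ∀ K : Finset Freq, finNorm K (fun k => (√(lam k) : ℂ) *
      heatResponse ε (ε * ν * lam k) (fun s => accumulated f f₀ s k) τ) ≤ δ) :
    ‖Ω τ - Ω' τ‖ ^ 2 ≤ 2 * δ ^ 2 + ∫ s in (0 : ℝ)..τ,
      ε / ν * ‖vorticityDrift (Ω s) (P s) - vorticityDrift (Ω' s) (P' s)‖ ^ 2 := by
  have hn : Continuous fun s => vorticityDrift (Ω s) (P s) - vorticityDrift (Ω' s) (P' s) :=
    (Continuous.vorticityDrift h.cont_vorticity h.cont_density).sub
    (Continuous.vorticityDrift h'.cont_vorticity h'.cont_density)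
  set V : ℝ → Coeffs := fun t k => (√(lam k) : ℂ) *
      heatResponse ε (ε * ν * lam k) (fun s => accumulated f f₀ s k) t with hV
  -- The response is known only through finite sets of frequencies, so `W` is a bare family and the
  -- estimates are made for each `K`. Splitting the difference as `W + V` doubles both squares,
  -- whence `2 δ²` and `ε / ν`.
  set W : ℝ → Coeffs := fun t k => Ω t k - Ω' t k - V t k with hW
  have hW0 : W 0 = 0 := by
    ext k; simp [hW, hV, h0, heatResponse, duhamel_zero, accumulated_zero]
  have hWeq := sum_norm_sq_le_add_integral (Y := W) hν hε hn (fun k => by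
    have h1 := continuous_eval h.cont_vorticity k
    have h2 := continuous_eval h'.cont_vorticity k
    have h3 := continuous_heatResponse ε (ε * ν * lam k) (hf.continuous_accumulated k)
    simp only [hW, hV]
    fun_prop) (fun t ht k => by
      rw [hW0, Pi.zero_apply, zero_add]
      exact vorticity_sub_response_eq hf h h' h0 ht k) hτ
  refine le_of_tendsto (hasSum_norm_sq (Ω τ - Ω' τ)) (Eventually.of_forall fun K => ?_)
  have h1 := hWeq K
  rw [hW0] at h1
  simp only [Pi.zero_apply, norm_zero, ne_eq, OfNat.ofNat_ne_zero, not_false_eq_true, zero_pow,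
    Finset.sum_const_zero, zero_add, ← sq_finNorm] at h1
  have h2 : finNorm K (Ω τ - Ω' τ : SeqSpace) ≤ finNorm K (W τ) + finNorm K (V τ) := by
    refine le_trans (le_of_eq ?_) (finNorm_add_le K (W τ) (V τ))
    congr 1
    ext k
    simp [hW]
  have h3 : ∫ s in (0 : ℝ)..τ,
      ε / ν * ‖vorticityDrift (Ω s) (P s) - vorticityDrift (Ω' s) (P' s)‖ ^ 2 =
      2 * ∫ s in (0 : ℝ)..τ, ε / (2 * ν) *
        ‖vorticityDrift (Ω s) (P s) - vorticityDrift (Ω' s) (P' s)‖ ^ 2 := by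
    rw [← intervalIntegral.integral_const_mul]
    congr 1; ext s; field_simp
  rw [h3, ← sq_finNorm]
  have h4 := finNorm_nonneg K (Ω τ - Ω' τ : SeqSpace)
  have h5 := finNorm_nonneg K (V τ)
  have h6 : finNorm K (V τ) ^ 2 ≤ δ ^ 2 := by gcongr; exact hδ K
  have h7 : finNorm K (Ω τ - Ω' τ : SeqSpace) ^ 2 ≤ (finNorm K (W τ) + finNorm K (V τ)) ^ 2 := by
    gcongr
  have h8 := sq_nonneg (finNorm K (W τ) - finNorm K (V τ))
  linarith

lemma norm_density_sub_sq_le (hμ : 0 < μ) (hε : 0 ≤ ε) {F F' : ℝ → Coeffs}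
    (h : IsModeSolution ν μ N ε S F Ω P) (h' : IsModeSolution ν μ N ε S F' Ω' P')
    (h0 : P 0 = P' 0) {τ : ℝ} (hτ : τ ∈ Set.Icc 0 S) :
    ‖P τ - P' τ‖ ^ 2 ≤ ∫ s in (0 : ℝ)..τ,
      ε / (2 * μ) * ‖densityDrift N (Ω s) (P s) - densityDrift N (Ω' s) (P' s)‖ ^ 2 := by
  have hm := Continuous.densityDrift N h.cont_vorticity h.cont_density
  have hm' := Continuous.densityDrift N h'.cont_vorticity h'.cont_density
  refine (norm_sq_le_add_integral (Y := fun s => P s - P' s)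
    (n := fun s => densityDrift N (Ω s) (P s) - densityDrift N (Ω' s) (P' s)) hμ hε (hm.sub hm')
    (h.cont_density.sub h'.cont_density) (fun t ht k => ?_) hτ).trans_eq (by simp [h0])
  have h1 := continuous_eval hm k
  have h2 := continuous_eval hm' k
  have h3 := continuous_eval h.cont_density k
  have h4 := continuous_eval h'.cont_density k
  have e : ∀ s, (ε : ℂ) * (-(μ * lam k : ℝ) * (P s - P' s) k + (√(lam k) : ℂ) *
        (densityDrift N (Ω s) (P s) - densityDrift N (Ω' s) (P' s)) k) =
      (ε : ℂ) * (-(μ * lam k : ℝ) * P s k + (√(lam k) : ℂ) * densityDrift N (Ω s) (P s) k) -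
      (ε : ℂ) * (-(μ * lam k : ℝ) * P' s k +
        (√(lam k) : ℂ) * densityDrift N (Ω' s) (P' s) k) := fun s => by
    rw [lp.coeFn_sub, Pi.sub_apply, lp.coeFn_sub, Pi.sub_apply]; ring
  simp only [e]
  rw [intervalIntegral.integral_sub (Continuous.intervalIntegrable (by fun_prop) _ _)
    (Continuous.intervalIntegrable (by fun_prop) _ _), lp.coeFn_sub, lp.coeFn_sub, Pi.sub_apply,
    Pi.sub_apply, h.eq_density t ht k, h'.eq_density t ht k]
  ring

lemma le_of_bootstrap {y : ℝ → ℝ} (hy : Continuous y) {q : ℝ} (hq : q < 1) (h0 : y 0 ≤ 1)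
    (h : ∀ τ ∈ Set.Icc 0 S, (∀ s ∈ Set.Icc 0 τ, y s ≤ 1) → y τ ≤ q) :
    ∀ τ ∈ Set.Icc 0 S, y τ ≤ q := by
  have hsub : Set.Icc 0 S ⊆ {s | y s ≤ 1} := by
    refine IsClosed.Icc_subset_of_forall_mem_nhdsGT_of_Icc_subset
      ((isClosed_le hy continuous_const).inter isClosed_Icc) h0 fun t ht hsub => ?_
    have h1 := (h t ⟨ht.1, ht.2.le⟩ hsub).trans_lt hq
    exact mem_nhdsWithin_of_mem_nhds ((hy.tendsto t).eventually_le_const h1)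
  exact fun τ hτ => h τ hτ fun s hs => hsub ⟨hs.1, hs.2.trans hτ.2⟩

/-- The Lipschitz bound on the ball of radius `B` gives Gronwall a rate proportional to `ε`; since
`ε τ ≤ T`, the exponential does not depend on `ε`. -/
lemma sub_sq_le_of_bounded {d B T : ℝ} (hd : 0 < d) (hν : d ≤ ν) (hμ : d ≤ μ) (hε : 0 < ε)
    (hST : S ≤ T / ε) (hB : 0 ≤ B) (hf : HasTimeAverage κ γ f f₀)
    (h : IsModeSolution ν μ N ε S f Ω P) (h' : IsModeSolution ν μ N ε S (fun _ => f₀) Ω' P')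
    (h0 : Ω 0 = Ω' 0) (h0' : P 0 = P' 0) {δ : ℝ}
    (hδ : ∀ t ∈ Set.Icc 0 S, ∀ K : Finset Freq, finNorm K (fun k => (√(lam k) : ℂ) *
      heatResponse ε (ε * ν * lam k) (fun s => accumulated f f₀ s k) t) ≤ δ) {τ : ℝ}
    (hτ : τ ∈ Set.Icc 0 S) (hb : ∀ s ∈ Set.Icc 0 τ, ‖Ω s‖ ≤ B ∧ ‖P s‖ ≤ B ∧ ‖Ω' s‖ ≤ B) :
    ‖Ω τ - Ω' τ‖ ^ 2 + ‖P τ - P' τ‖ ^ 2 ≤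
      2 * δ ^ 2 * Real.exp (4 * driftLip N B ^ 2 / d * T) := by
  have hΩc := h.cont_vorticity
  have hΩc' := h'.cont_vorticity
  have hPc := h.cont_density
  have hPc' := h'.cont_density
  have hn : Continuous fun s => vorticityDrift (Ω s) (P s) - vorticityDrift (Ω' s) (P' s) :=
    (Continuous.vorticityDrift hΩc hPc).sub (Continuous.vorticityDrift hΩc' hPc')
  have hm : Continuous fun s => densityDrift N (Ω s) (P s) - densityDrift N (Ω' s) (P' s) :=
    (Continuous.densityDrift N hΩc hPc).sub (Continuous.densityDrift N hΩc' hPc')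
  set b : ℝ := ε / d * (4 * driftLip N B ^ 2) with hb_def
  have hb0 : 0 ≤ b := by positivity
  have hmain := le_mul_exp_integral (u := fun s => ‖Ω s - Ω' s‖ ^ 2 + ‖P s - P' s‖ ^ 2)
    (b := fun _ => b) (A := 2 * δ ^ 2) (S := τ) (by fun_prop) continuous_const (fun _ => hb0)
    (fun t ht => ?_) ⟨hτ.1, le_rfl⟩
  · refine hmain.trans ?_
    rw [intervalIntegral.integral_const, sub_zero, smul_eq_mul]
    refine mul_le_mul_of_nonneg_left (Real.exp_le_exp.2 ?_) (by positivity)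
    have h1 : ε * τ ≤ T := by
      have := hτ.2.trans hST
      rwa [le_div_iff₀ hε, mul_comm] at this
    calc τ * b = 4 * driftLip N B ^ 2 / d * (ε * τ) := by rw [hb_def]; ring
      _ ≤ _ := by gcongr
  · have htS : t ∈ Set.Icc 0 S := ⟨ht.1, ht.2.trans hτ.2⟩
    have h1 := norm_vorticity_sub_sq_le (hd.trans_le hν) hε.le hf h h' h0 htS (hδ t htS)
    have h2 := norm_density_sub_sq_le (hd.trans_le hμ) hε.le h h' h0' htS
    have i1 : Continuous fun s => ε / ν * ‖vorticityDrift (Ω s) (P s) -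
        vorticityDrift (Ω' s) (P' s)‖ ^ 2 := by fun_prop
    have i2 : Continuous fun s => ε / (2 * μ) * ‖densityDrift N (Ω s) (P s) -
        densityDrift N (Ω' s) (P' s)‖ ^ 2 := by fun_prop
    have h3 : ∫ s in (0 : ℝ)..t, (ε / ν * ‖vorticityDrift (Ω s) (P s) -
        vorticityDrift (Ω' s) (P' s)‖ ^ 2 + ε / (2 * μ) * ‖densityDrift N (Ω s) (P s) -
        densityDrift N (Ω' s) (P' s)‖ ^ 2) ≤
        ∫ s in (0 : ℝ)..t, b * (‖Ω s - Ω' s‖ ^ 2 + ‖P s - P' s‖ ^ 2) := by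
      refine intervalIntegral.integral_mono_on ht.1 ((i1.add i2).intervalIntegrable _ _)
        (Continuous.intervalIntegrable (by fun_prop) _ _) fun s hs => ?_
      obtain ⟨b1, b2, b3⟩ := hb s ⟨hs.1, hs.2.trans ht.2⟩
      have h4 := drift_sub_sq_le N (P' := P' s) hB b1 b2 b3
      have h5 : ε / ν ≤ ε / d := by gcongr
      have h6 : ε / (2 * μ) ≤ ε / d := by
        gcongr; linarith
      calc _ ≤ ε / d * ‖vorticityDrift (Ω s) (P s) - vorticityDrift (Ω' s) (P' s)‖ ^ 2 +
            ε / d * ‖densityDrift N (Ω s) (P s) - densityDrift N (Ω' s) (P' s)‖ ^ 2 := by gcongr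
        _ ≤ ε / d * (4 * driftLip N B ^ 2 * (‖Ω s - Ω' s‖ ^ 2 + ‖P s - P' s‖ ^ 2)) := by
          rw [← mul_add]; gcongr
        _ = _ := by rw [hb_def]; ring
    rw [intervalIntegral.integral_add (i1.intervalIntegrable _ _)
      (i2.intervalIntegrable _ _)] at h3
    linarith

end Difference

/-- Averaging for the equations of the Fourier modes. -/
theorem eventually_norm_sub_sq_le {ν μ N γ T A : ℝ} (hν : 0 < ν) (hμ : 0 < μ)
    (hγ : -(1 / 2) < γ) (hT : 0 < T) {f : ℝ → Coeffs} {f₀ : Coeffs}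
    (hf : HasTimeAverage ν γ f f₀) {q : ℝ} (hq : 0 < q) (hq1 : q < 1) :
    ∀ᶠ ε in 𝓝[>] (0 : ℝ), ∀ S, S ≤ T / ε → ∀ Ω P Ω' P' : ℝ → SeqSpace,
      IsModeSolution ν μ N ε S f Ω P → IsModeSolution ν μ N ε S (fun _ => f₀) Ω' P' →
      Ω 0 = Ω' 0 → P 0 = P' 0 → ‖Ω 0‖ ≤ A → ‖P 0‖ ≤ A →
      ∀ τ ∈ Set.Icc 0 S, ‖Ω τ - Ω' τ‖ ^ 2 + ‖P τ - P' τ‖ ^ 2 ≤ q := by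
  obtain ⟨R, hR0, hR⟩ := exists_norm_bound (N := N) (T := T) hν hμ hγ hf.mem_average A
  set d := min ν μ
  have hd : 0 < d := lt_min hν hμ
  set E := Real.exp (4 * driftLip N (R + 1) ^ 2 / d * T)
  have hE : 0 < E := Real.exp_pos _
  -- Chosen so that the Gronwall bound equals `q`. In `E` the radius is `R + 1` because the
  -- bootstrap keeps the difference at most `1`.
  set δ := √(q / (2 * E)) with hδ
  have hδ0 : 0 < δ := Real.sqrt_pos.2 (by positivity)
  have hδq : 2 * δ ^ 2 * E = q := by
    rw [hδ, Real.sq_sqrt (by positivity)]; field_simp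
  -- Truncation at `0` ensures `p = 1/2 - γ' ≥ 0`; below, `r` is half of the gap `1 - p = 1/2 + γ'`.
  set γ' := min γ 0
  have hγ' : -(1 / 2) < γ' := lt_min hγ (by norm_num)
  have hγ0 : γ' ≤ 0 := min_le_right _ _
  have hlin := eventually_finNorm_heatResponse_le (p := 1 / 2 - γ') (r := (1 / 2 + γ') / 2) hν
    (by linarith) (by linarith) (by linarith) hT (G := accumulated f f₀)
    hf.continuous_accumulated (accumulated_zero f f₀) (fun δ hδ => by
      rw [sub_sub_cancel]
      exact hf.exists_increment_bound hν (min_le_left _ _) (by linarith) hδ) hδ0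
  filter_upwards [hlin, self_mem_nhdsWithin] with ε hlin hε S hST Ω P Ω' P' h h' h0 h0' hA hA'
  have hε : 0 < ε := hε
  have hR' := hR ε hε S hST Ω' P' h' (h0 ▸ hA) (h0' ▸ hA')
  have hΩc := h.cont_vorticity
  have hΩc' := h'.cont_vorticity
  have hPc := h.cont_density
  have hPc' := h'.cont_density
  refine le_of_bootstrap (y := fun s => ‖Ω s - Ω' s‖ ^ 2 + ‖P s - P' s‖ ^ 2) (by fun_prop) hq1
    (by simp [h0, h0']) fun τ hτ hle => ?_
  have hmain := sub_sq_le_of_bounded hd (min_le_left _ _) (min_le_right _ _) hε hST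
    (by linarith : 0 ≤ R + 1) hf h h' h0 h0' (δ := δ)
    (fun t ht K => hlin t ht.1 (ht.2.trans hST) K) hτ (fun s hs => ?_)
  · exact hmain.trans_eq hδq
  · obtain ⟨b1, b2⟩ := hR' s ⟨hs.1, hs.2.trans hτ.2⟩
    have hy : ‖Ω s - Ω' s‖ ^ 2 + ‖P s - P' s‖ ^ 2 ≤ 1 := hle s hs
    have c1 : ‖Ω s - Ω' s‖ ≤ 1 := by nlinarith [sq_nonneg ‖P s - P' s‖]
    have c2 : ‖P s - P' s‖ ≤ 1 := by nlinarith [sq_nonneg ‖Ω s - Ω' s‖]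
    have d1 := norm_le_norm_add_norm_sub' (Ω s) (Ω' s)
    have d2 := norm_le_norm_add_norm_sub' (P s) (P' s)
    exact ⟨by linarith, by linarith, by linarith⟩

/-! ### The rate function and the return to the original unknowns -/

/-- The rate is the infimum of the admissible bounds plus `ε`, so the infimum need not be attained.
The case `η = 1` provides `ε₀`, below which there is an admissible bound. -/
lemma exists_rate_of_eventually {p : ℝ → ℝ → Prop}
    (hmono : ∀ ε a b, a ≤ b → p ε a → p ε b)
    (h : ∀ η, 0 < η → ∀ᶠ ε in 𝓝[>] (0 : ℝ), p ε η) :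
    ∃ ε₀ : ℝ, 0 < ε₀ ∧ ∃ η : ℝ → ℝ, Tendsto η (𝓝[>] 0) (𝓝 0) ∧
      ∀ ε, 0 < ε → ε < ε₀ → p ε (η ε) := by
  obtain ⟨ε₀, hε₀, h1⟩ := mem_nhdsGT_iff_exists_Ioo_subset.1 (h 1 one_pos)
  set s : ℝ → Set ℝ := fun ε => {a | 0 < a ∧ p ε a}
  have hbdd : ∀ ε, BddBelow (s ε) := fun ε => ⟨0, fun a ha => ha.1.le⟩
  refine ⟨ε₀, hε₀, fun ε => sInf (s ε) + ε, ?_, fun ε hε hεε => ?_⟩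
  · rw [Metric.tendsto_nhds]
    intro e he
    filter_upwards [h (e / 2) (half_pos he), self_mem_nhdsWithin,
      Ioo_mem_nhdsGT (half_pos he)] with ε hp hε hε2
    have hε : 0 < ε := hε
    have h2 : sInf (s ε) ≤ e / 2 := csInf_le (hbdd ε) ⟨half_pos he, hp⟩
    have h3 : 0 ≤ sInf (s ε) := Real.sInf_nonneg fun a ha => ha.1.le
    rw [Real.dist_eq, sub_zero, abs_of_nonneg (by linarith)]
    linarith [hε2.2]
  · have hne : (s ε).Nonempty := ⟨1, one_pos, h1 ⟨hε, hεε⟩⟩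
    obtain ⟨a, ha, hlt⟩ := exists_lt_of_csInf_lt hne (lt_add_of_pos_right (sInf (s ε)) hε)
    exact hmono ε a _ hlt.le ha.2

/-- The solutions of the oscillating and of the averaged system with the same initial data in the
ball of radius `R₀` differ by at most `e` on time intervals of length at most `T / ε`. -/
def SolutionsClose (ν Pr N T R₀ : ℝ) (f : ℝ → Coeffs) (f₀ : Coeffs) (ε e : ℝ) : Prop :=
  ∀ S : ℝ, 0 ≤ S → S ≤ T / ε → ∀ ω ρ ω' ρ' : ℝ → L2,
    IsSolution ν Pr N ε S f ω ρ → IsSolution ν Pr N ε S (fun _ => f₀) ω' ρ' →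
    ω 0 = ω' 0 → ρ 0 = ρ' 0 →
    normDA ν (1 / 2) (coeff (ω 0)) + normDA (ν / Pr) (1 / 2) (coeff (ρ 0)) ≤ R₀ →
    ∀ τ ∈ Set.Icc 0 S,
      normDA ν (1 / 2) (coeff (ω τ - ω' τ)) + normDA (ν / Pr) (1 / 2) (coeff (ρ τ - ρ' τ)) ≤ e

lemma SolutionsClose.mono {ν Pr N T R₀ : ℝ} {f : ℝ → Coeffs} {f₀ : Coeffs} {ε a b : ℝ}
    (hab : a ≤ b) (h : SolutionsClose ν Pr N T R₀ f f₀ ε a) :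
    SolutionsClose ν Pr N T R₀ f f₀ ε b :=
  fun S hS hST ω ρ ω' ρ' h1 h2 h3 h4 h5 τ hτ =>
    (h S hS hST ω ρ ω' ρ' h1 h2 h3 h4 h5 τ hτ).trans hab

lemma eventually_solutionsClose {ν Pr γ T : ℝ} (N R₀ : ℝ) (hν : 0 < ν) (hPr : 0 < Pr)
    (hγ : -(1 / 2) < γ) {f : ℝ → Coeffs} {f₀ : Coeffs} (hf : HasTimeAverage ν γ f f₀)
    (hT : 0 < T) {η : ℝ} (hη : 0 < η) :
    ∀ᶠ ε in 𝓝[>] (0 : ℝ), SolutionsClose ν Pr N T R₀ f f₀ ε η := by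
  have hμ : 0 < ν / Pr := div_pos hν hPr
  set c := √ν + √(ν / Pr) with hc
  have hsν : 0 < √ν := Real.sqrt_pos.2 hν
  have hsμ : 0 < √(ν / Pr) := Real.sqrt_pos.2 hμ
  have hc0 : 0 < c := add_pos hsν hsμ
  -- The first entry gives `q < 1` for the bootstrap; the second makes both norms at most `η / c`,
  -- and their weights add up to `c`.
  set q := min (1 / 2) ((η / c) ^ 2) with hq
  have hq0 : 0 < q := lt_min (by norm_num) (by positivity)
  filter_upwards [eventually_norm_sub_sq_le (N := N) (A := max (R₀ / √ν) (R₀ / √(ν / Pr))) hν hμ hγ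
    hT hf hq0 ((min_le_left _ _).trans_lt (by norm_num))] with ε hε S hS hST ω ρ ω' ρ' hs hs' h0 h0'
    hR τ hτ
  obtain ⟨Ω, P, hM, hv⟩ := hs.exists_isModeSolution hν hPr hS hf.integrable
  obtain ⟨Ω', P', hM', hv'⟩ := hs'.exists_isModeSolution hν hPr hS
    fun _ _ _ => intervalIntegrable_const
  have hz : (0 : ℝ) ∈ Set.Icc 0 S := ⟨le_rfl, hS⟩
  rw [(hs.mem_vorticity 0 hz).normDA_half hν, (hs.mem_density 0 hz).normDA_half hμ,
    ← (hv 0 hz).1, ← (hv 0 hz).2] at hR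
  have hA : ‖Ω 0‖ ≤ R₀ / √ν := by
    rw [le_div_iff₀ hsν, mul_comm]
    linarith [mul_nonneg hsμ.le (norm_nonneg (P 0))]
  have hA' : ‖P 0‖ ≤ R₀ / √(ν / Pr) := by
    rw [le_div_iff₀ hsμ, mul_comm]
    linarith [mul_nonneg hsν.le (norm_nonneg (Ω 0))]
  have hmain := hε S hST Ω P Ω' P' hM hM' (by rw [(hv 0 hz).1, (hv' 0 hz).1, h0])
    (by rw [(hv 0 hz).2, (hv' 0 hz).2, h0']) (hA.trans (le_max_left _ _))
    (hA'.trans (le_max_right _ _)) τ hτ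
  have hq2 : q ≤ (η / c) ^ 2 := min_le_right _ _
  have hηc : 0 ≤ η / c := by positivity
  have b1 : ‖Ω τ - Ω' τ‖ ≤ η / c :=
    le_of_sq_le_sq (by linarith [sq_nonneg ‖P τ - P' τ‖]) hηc
  have b2 : ‖P τ - P' τ‖ ≤ η / c :=
    le_of_sq_le_sq (by linarith [sq_nonneg ‖Ω τ - Ω' τ‖]) hηc
  have m1 := hs.mem_vorticity τ hτ
  have m1' := hs'.mem_vorticity τ hτ
  have m2 := hs.mem_density τ hτ
  have m2' := hs'.mem_density τ hτ
  rw [coeff_sub, coeff_sub, (m1.sub m1').normDA_half hν, (m2.sub m2').normDA_half hμ,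
    m1.sqrtLap_sub m1', m2.sqrtLap_sub m2', ← (hv τ hτ).1, ← (hv τ hτ).2, ← (hv' τ hτ).1,
    ← (hv' τ hτ).2]
  calc _ ≤ √ν * (η / c) + √(ν / Pr) * (η / c) := by gcongr
    _ = η := by rw [← add_mul, ← hc, mul_div_cancel₀ _ hc0.ne']

end Thermohaline
end
theorem theorem3p6 (ν Pr N γ : ℝ) (hν : 0 < ν) (hPr : 0 < Pr) (hN : 0 < N) (hγ : -(1 / 2) < γ)
    (f : ℝ → Thermohaline.Coeffs) (f₀ : Thermohaline.Coeffs)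
    (hf : Thermohaline.HasTimeAverage ν γ f f₀)
    (T : ℝ) (hT : 0 < T) (R₀ : ℝ) (hR₀ : 0 < R₀) :
    ∃ ε₀ : ℝ, 0 < ε₀ ∧ ∃ η : ℝ → ℝ, Tendsto η (𝓝[>] 0) (𝓝 0) ∧
      ∀ ε : ℝ, 0 < ε → ε < ε₀ →
      ∀ S : ℝ, 0 ≤ S → S ≤ T / ε →
      ∀ ω ρ ω' ρ' : ℝ → Thermohaline.L2,
        Thermohaline.IsSolution ν Pr N ε S f ω ρ →
        Thermohaline.IsSolution ν Pr N ε S (fun _ => f₀) ω' ρ' →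
        ω 0 = ω' 0 → ρ 0 = ρ' 0 →
        Thermohaline.normDA ν (1 / 2) (Thermohaline.coeff (ω 0))
          + Thermohaline.normDA (ν / Pr) (1 / 2) (Thermohaline.coeff (ρ 0)) ≤ R₀ →
        ∀ τ ∈ Set.Icc 0 S,
          Thermohaline.normDA ν (1 / 2) (Thermohaline.coeff (ω τ - ω' τ))
            + Thermohaline.normDA (ν / Pr) (1 / 2) (Thermohaline.coeff (ρ τ - ρ' τ)) ≤ η ε := 
  Thermohaline.exists_rate_of_eventually
    (p := fun ε e => Thermohaline.SolutionsClose ν Pr N T R₀ f f₀ ε e)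
    (fun _ _ _ hab h => h.mono hab)
    fun _ hη => Thermohaline.eventually_solutionsClose N R₀ hν hPr hγ hf hT hη
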